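/- Setting. A smooth regular Jordan curve $\Gamma$ in the plane is given by a $1$-periodic smooth parametrization $x(u)$ with positive orientation; $T=\partial_s x=(\cos\nu,\sin\nu)$ is the unit tangent ($s$ arc length, $\nu$ the tangent angle), $N=(-\sin\nu,\cos\nu)$ the inward unit normal, $k=\det(\partial_s x,\partial_s^2x)$ the curvature, $L$ the length, and $A=\frac12\int_0^1\det(x,\partial_u x)\,du$ the enclosed area. An anisotropy function is a smooth, strictly positive, $2\pi$-periodic function $\sigma=\sigma(\nu)$; put $L_\sigma(\Gamma)=\int_\Gamma\sigma(\nu)\,ds$, $k_\sigma=(\sigma(\nu)+\sigma''(\nu))k$, and let $W_\sigma=\bigcap_{\nu}\{z\in\mathbb R^2:\ -z\cdot(-\sin\nu,\cos\nu)\le\sigma(\nu)\}$ be the Wulff shape, with area $|W_\sigma|$. The anisoperimetric ratio gradient flow is a smooth family $\Gamma^t$, $t\in[0,T_{max})$ with $0<T_{max}\le\infty$ (smooth up to $t=0$), of smooth Jordan curves satisfying $\partial_t x=\beta N+\alpha T$ with $\beta=k_\sigma-\frac{L_\sigma}{2A}$ and an arbitrary tangential velocity $\alpha$. For $\sigma\equiv1$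 one has $\beta=k-\frac{L}{2A}$ and the flow is called the isoperimetric ratio gradient flow. Theorem. (I) Let $\Gamma^t$, $t\in[0,T_{max})$, be an isoperimetric ratio gradient flow ($\sigma\equiv1$). Then $t\mapsto A(\Gamma^t)$ is nondecreasing on $[0,T_{max})$. If moreover $\Gamma^0$ is convex, then $t\mapsto L(\Gamma^t)$ is nonincreasing on $[0,T_{max})$. (II) Let $\sigma$ be an anisotropy function with $\sigma+\sigma''>0$ and such that $\sigma+\sigma''$ is not constant (equivalently, $W_\sigma$ is not a disk). Let $a,b>0$ be constants, $\bar\sigma=a\sigma+b$, and let $\Gamma^t$, $t\in[0,T_{max})$, be an anisoperimetric ratio gradient flow for $\sigma$ whose initial curve is homothetic to $\partial W_{\bar\sigma}$, i.e. $\Gamma^0=p+r\,\partial W_{\bar\sigma}$ for some $p\in\mathbb R^2$, $r>0$. Then 1. $\frac{d}{dt}L(\Gamma^t)>0$ at $t=0$; 2. if moreover $a/b=\sqrt{\pi}/\sqrt{|W_\sigma|}$, then $\frac{d}{dt}A(\Gamma^t)<0$ at $t=0$. The derivatives at $t=0$ are one-sided, and their existence is part of the assertion. -/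

import Mathlib

open scoped ContDiff

/-! The Euclidean plane is `ℂ` with its real inner product and Lebesgue measure.
Closed curves are `1`-periodic maps `ℝ → ℂ`; anisotropies are `2π`-periodic maps `ℝ → ℝ` of the
tangent angle. -/

noncomputable section

namespace AnisoFlow

/-- The determinant of the `2 × 2` matrix with columns `a`, `b`. -/
def det (a b : ℂ) : ℝ := a.re * b.im - a.im * b.re

/-! ### Geometry of a parametrized closed curve -/

/-- The local length `g = |∂ᵤ x|`, so that `ds = g du`. -/
def speed (x : ℝ → ℂ) (u : ℝ) : ℝ := ‖deriv x u‖

/-- The arc-length derivative `∂ₛ f = g⁻¹ ∂ᵤ f` of a function `f` along the curve `x`. -/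
def arcDeriv (x f : ℝ → ℂ) (u : ℝ) : ℂ := (speed x u)⁻¹ • deriv f u

/-- The unit tangent vector `T = ∂ₛ x`. -/
def tangent (x : ℝ → ℂ) : ℝ → ℂ := arcDeriv x x

/-- The unit normal vector `N`, i.e. `T` rotated by `π / 2`, so that `det (T, N) = 1`; it points
inward when the curve is a positively oriented Jordan curve. -/
def normal (x : ℝ → ℂ) (u : ℝ) : ℂ := Complex.I * tangent x u

/-- The signed curvature `k = det (∂ₛ x, ∂ₛ² x)`. -/
def curvature (x : ℝ → ℂ) (u : ℝ) : ℝ := det (arcDeriv x x u) (arcDeriv x (arcDeriv x x) u)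

/-- The tangent angle `ν`, with `T = (cos ν, sin ν)`, represented in `(-π, π]`. It is only used
inside `2π`-periodic functions. -/
def tangentAngle (x : ℝ → ℂ) (u : ℝ) : ℝ := Complex.arg (tangent x u)

/-- The integral `∫_Γ f ds` over the closed curve. -/
def curveIntegral (x : ℝ → ℂ) (f : ℝ → ℝ) : ℝ := ∫ u in (0 : ℝ)..1, f u * speed x u

/-- The length `L = ∫_Γ ds`. -/
def length (x : ℝ → ℂ) : ℝ := curveIntegral x fun _ => 1

/-- The total interfacial energy `L_σ = ∫_Γ σ(ν) ds`. -/
def energy (σ : ℝ → ℝ) (x : ℝ → ℂ) : ℝ := curveIntegral x fun u => σ (tangentAngle x u)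

/-- The area `A = (1/2) ∫ det (x, ∂ᵤ x) du` enclosed by a positively oriented Jordan curve. -/
def area (x : ℝ → ℂ) : ℝ := 1 / 2 * ∫ u in (0 : ℝ)..1, det (x u) (deriv x u)

/-- The anisotropic curvature `k_σ = (σ(ν) + σ''(ν)) k`. -/
def anisoCurvature (σ : ℝ → ℝ) (x : ℝ → ℂ) (u : ℝ) : ℝ :=
  (σ (tangentAngle x u) + deriv (deriv σ) (tangentAngle x u)) * curvature x u

/-- Smooth regular Jordan curves, positively oriented (the signed area is positive), so
that `normal` points inward. -/
structure IsJordanCurve (x : ℝ → ℂ) : Prop where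
  smooth : ContDiff ℝ ∞ x
  periodic : Function.Periodic x 1
  regular : ∀ u, deriv x u ≠ 0
  simple : Set.InjOn x (Set.Ico 0 1)
  positive : 0 < area x

/-- A positively oriented Jordan curve is convex if it lies on the inner side of each of its
tangent lines. -/
def IsConvexCurve (x : ℝ → ℂ) : Prop := ∀ u v, 0 ≤ inner ℝ (x v - x u) (normal x u)

/-! ### Anisotropies and Wulff shapes -/

/-- A smooth anisotropy density: a strictly positive smooth function of the tangent angle. -/
structure IsAnisotropy (σ : ℝ → ℝ) : Prop where
  smooth : ContDiff ℝ ∞ σ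
  periodic : Function.Periodic σ (2 * Real.pi)
  pos : ∀ ν, 0 < σ ν

/-- The Wulff shape `W_σ`, the intersection over all angles `ν` of the half planes
`-x · N ≤ σ(ν)`, where `N = (-sin ν, cos ν)`. -/
def wulffShape (σ : ℝ → ℝ) : Set ℂ :=
  ⋂ ν : ℝ, {z : ℂ | -(inner ℝ z (⟨-Real.sin ν, Real.cos ν⟩ : ℂ)) ≤ σ ν}

/-- The area `|W_σ|` of the Wulff shape. -/
def wulffArea (σ : ℝ → ℝ) : ℝ := (MeasureTheory.volume (wulffShape σ)).toReal

/-- The sets `S` and `S'` are homothetically similar: `S = p + r S'` with `r > 0`. -/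
def Homothetic (S S' : Set ℂ) : Prop :=
  ∃ (p : ℂ) (r : ℝ), 0 < r ∧ S = (fun z : ℂ => p + r • z) '' S'

/-! ### The anisoperimetric ratio gradient flow -/

/-- The time interval `[0, T)`, where `T = ∞` is allowed. -/
def timeInterval (T : EReal) : Set ℝ := {t : ℝ | 0 ≤ t ∧ (t : EReal) < T}

/-- The normal velocity `β = k_σ - L_σ / (2 A)`. -/
def normalVelocity (σ : ℝ → ℝ) (x : ℝ → ℂ) (u : ℝ) : ℝ :=
  anisoCurvature σ x u - energy σ x / (2 * area x)

/-- `x t`, `t ∈ [0, T)`, is a smooth family of Jordan curves that solves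
`∂ₜ x = β N + α T` with `β = k_σ - L_σ / (2 A)` and some tangential velocity `α`. At `t = 0` the
time derivative is one-sided. -/
structure IsGradientFlow (σ : ℝ → ℝ) (T : EReal) (x : ℝ → ℝ → ℂ) : Prop where
  pos : 0 < T
  smooth : ContDiffOn ℝ ∞ (fun q : ℝ × ℝ => x q.1 q.2) (timeInterval T ×ˢ Set.univ)
  jordan : ∀ t ∈ timeInterval T, IsJordanCurve (x t)
  evolution : ∃ α : ℝ → ℝ → ℝ, ∀ t ∈ timeInterval T, ∀ u,
    HasDerivWithinAt (fun τ => x τ u)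
      (normalVelocity σ (x t) u • normal (x t) u + α t u • tangent (x t) u) (timeInterval T) t

end AnisoFlow

end

section

open Set Filter Topology MeasureTheory

namespace AnisoFlow

/-! ### A weighted Wirtinger inequality -/

/-! The first variation formulas are `A' = -∫ β ds` and `L' = -∫ k β ds`. For `σ = 1` they read `A'
= L²/(2A) - ∫ k ds` and `L' = (L/(2A)) ∫ k ds - ∫ k² ds`. Hopf's Umlaufsatz (`integral_turning_eq`)
gives `∫ k ds ≤ 2π`, so the isoperimetric inequality `4πA ≤ L²` makes `A` nondecreasing. If the
initial curve is convex, a maximum principle (`curvature_nonneg`) keeps `k ≥ 0`; then `∫ k ds = 2π`,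
and Gage's inequality `∫ k² ds ≥ πL/A` gives `L' ≤ 0`.

For the anisotropic part, a curve homothetic to the boundary of the Wulff shape of `aσ + b` has
support function `r(aσ + b)` and radius of curvature `r(a(σ + σ'') + b)`, both as functions of the
tangent angle. Substituting these into `β` yields `β = -(b/a)(k - L/(2A))`: at time zero the flow is
the isoperimetric flow run backwards, at speed `b/a`. Both monotonicities are therefore reversed,
and they are strict because a nonconstant `σ + σ''` prevents the curve from being a circle. The
formulas for `L'` and `A'` are proved for `t > 0` and reach `t = 0` by continuity.

The two geometric inequalities both come from a Wirtinger inequality on an angular interval of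
length `π` (`integral_mul_sq_le_integral_mul_sq_of_eq_zero`). Applied to the two halves of a closed
curve of equal length, it gives the isoperimetric inequality. Applied to the support function, it
gives a Bonnesen inequality for each arc cut off by a chord with opposite tangents at its ends. When
that chord also bisects the area, integrating Bonnesen over the curve gives `π ∫ p² ds ≤ A L`, and
this together with `∫ k p ds = L` implies Gage's inequality. -/

theorem min_le_pi_div_two_mul_sin {t : ℝ} (h0 : 0 ≤ t) (h1 : t ≤ Real.pi) :
    min t (Real.pi - t) ≤ Real.pi / 2 * Real.sin t := by
  have hpi := Real.pi_pos
  rcases le_total t (Real.pi / 2) with h | h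
  · have := Real.mul_le_sin h0 h
    calc min t (Real.pi - t) ≤ t := min_le_left _ _
      _ = Real.pi / 2 * (2 / Real.pi * t) := by field_simp
      _ ≤ _ := by gcongr
  · have := Real.mul_le_sin (x := Real.pi - t) (by linarith) (by linarith)
    rw [Real.sin_pi_sub] at this
    calc min t (Real.pi - t) ≤ Real.pi - t := min_le_right _ _
      _ = Real.pi / 2 * (2 / Real.pi * (Real.pi - t)) := by field_simp
      _ ≤ _ := by gcongr

/-- Here `q` is the derivative of `f` with respect to the angle `θ`, so a bound on `q` is a
Lipschitz constant in `θ`. As `κ` may vanish, `θ` need not be a parameter; the proof uses that `Q θ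
± f` is monotone in `u`. -/
theorem abs_sub_le_mul_angle_sub {a b Q : ℝ} {θ κ f q : ℝ → ℝ}
    (hθ : ∀ u, HasDerivAt θ (κ u) u) (hf : ∀ u, HasDerivAt f (κ u * q u) u)
    (hκ0 : ∀ u, 0 ≤ κ u) (hQ : ∀ u ∈ Icc a b, |q u| ≤ Q)
    {u v : ℝ} (hu : u ∈ Icc a b) (hv : v ∈ Icc a b) (huv : u ≤ v) :
    |f v - f u| ≤ Q * (θ v - θ u) := by
  have key : ∀ σ : ℝ, |σ| ≤ 1 → MonotoneOn (fun u => Q * θ u + σ * f u) (Icc a b) := by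
    intro σ hσ
    have hd : ∀ u, HasDerivAt (fun u => Q * θ u + σ * f u) (Q * κ u + σ * (κ u * q u)) u :=
      fun u => ((hθ u).const_mul Q).add ((hf u).const_mul σ)
    refine monotoneOn_of_deriv_nonneg (convex_Icc a b)
      (fun u _ => (hd u).continuousAt.continuousWithinAt)
      (fun u _ => (hd u).differentiableAt.differentiableWithinAt) fun u hu => ?_
    rw [(hd u).deriv]
    have h1 := hQ u (interior_subset hu)
    have h2 : |σ * q u| ≤ Q := by
      rw [abs_mul]
      calc |σ| * |q u| ≤ 1 * |q u| := by gcongr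
        _ ≤ Q := by simpa using h1
    nlinarith [neg_le_of_abs_le h2, hκ0 u]
  have h1 := key 1 (by simp) hu hv huv
  have h2 := key (-1) (by simp) hu hv huv
  simp only at h1 h2
  rw [abs_le]
  constructor <;> linarith

/-- As a function of the angle, `f` is `π`-periodic with a zero at `θ c`. The inequality is the
nonnegativity of the integral of `(f_θ - f cot(θ - θ c))²`, after the exact derivative of `f² cot`
is removed. The cotangent is regularized by `ε`, and the resulting error tends to zero because `f`
vanishes where the sine does. -/
theorem integral_mul_sq_le_integral_mul_sq_of_eq_zero {a b c : ℝ} {θ κ f q : ℝ → ℝ}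
    (hθ : ∀ u, HasDerivAt θ (κ u) u) (hf : ∀ u, HasDerivAt f (κ u * q u) u)
    (hκ : Continuous κ) (hκ0 : ∀ u, 0 ≤ κ u) (hq : Continuous q)
    (hπ : θ b = θ a + Real.pi) (hfab : f b = f a) (hc : c ∈ Icc a b) (hfc : f c = 0) :
    ∫ u in a..b, κ u * f u ^ 2 ≤ ∫ u in a..b, κ u * q u ^ 2 := by
  have hab : a ≤ b := hc.1.trans hc.2
  have hfcont : Continuous f := continuous_iff_continuousAt.2 fun u => (hf u).continuousAt
  have hθcont : Continuous θ := continuous_iff_continuousAt.2 fun u => (hθ u).continuousAt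
  obtain ⟨Q, hQ⟩ : ∃ Q, ∀ u ∈ Icc a b, |q u| ≤ Q :=
    isCompact_Icc.exists_bound_of_continuousOn hq.continuousOn
  have hQ0 : 0 ≤ Q := (abs_nonneg _).trans (hQ c hc)
  have ha : a ∈ Icc a b := ⟨le_rfl, hab⟩
  have hb : b ∈ Icc a b := ⟨hab, le_rfl⟩
  have L := fun {u v : ℝ} (hu : u ∈ Icc a b) (hv : v ∈ Icc a b) (huv : u ≤ v) =>
    abs_sub_le_mul_angle_sub hθ hf hκ0 hQ hu hv huv
  have hmono : Monotone θ := monotone_of_deriv_nonneg (fun u => (hθ u).differentiableAt)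
    (fun u => by rw [(hθ u).deriv]; exact hκ0 u)
  set s : ℝ → ℝ := fun u => Real.sin (θ u - θ c) with hs
  set C : ℝ := Q * (Real.pi / 2) with hC
  -- The angular distance from `u` to `c` can be measured directly or the other way round, through
  -- the endpoints where `f` takes equal values. The Lipschitz bound on both routes gives `min t (π
  -- - t)`, which is comparable to the sine.
  have hbound : ∀ u ∈ Icc a b, |f u| ≤ C * |s u| := by
    intro u hu
    have h2 := L ha hc hc.1
    have h3 := L hc hb hc.2
    rw [hfc] at h2 h3
    rw [abs_sub_comm, sub_zero] at h2
    rw [sub_zero] at h3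
    have main : ∀ t, 0 ≤ t → t ≤ Real.pi → |f u| ≤ Q * t → |f u| ≤ Q * (Real.pi - t) →
        |f u| ≤ C * |Real.sin t| := by
      intro t t0 t1 h4 h5
      have h6 := min_le_pi_div_two_mul_sin t0 t1
      have : |f u| ≤ Q * min t (Real.pi - t) := by
        rcases min_choice t (Real.pi - t) with h | h <;> rw [h] <;> assumption
      rw [abs_of_nonneg (Real.sin_nonneg_of_nonneg_of_le_pi t0 t1), hC, mul_assoc]
      exact this.trans (by gcongr)
    rcases le_total c u with h | h
    · have h4 := L hc hu h
      have h5 := L hu hb hu.2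
      rw [hfc, sub_zero] at h4
      have h6 : |f u| ≤ |f b| + |f b - f u| := by
        have := abs_sub_abs_le_abs_sub (f u) (f b)
        rw [abs_sub_comm (f u)] at this; linarith
      rw [hfab] at h6
      refine main _ (by linarith [hmono h]) (by linarith [hmono hu.2, hmono hc.1]) h4 ?_
      rw [hfab] at h5
      nlinarith
    · have h4 := L hu hc h
      have h5 := L ha hu hu.1
      rw [hfc, abs_sub_comm, sub_zero] at h4
      have h6 : |f u| ≤ |f a| + |f u - f a| := by
        have := abs_sub_abs_le_abs_sub (f u) (f a); linarith
      have := main (θ c - θ u) (by linarith [hmono h]) (by linarith [hmono hu.1, hmono hc.2]) h4 (by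
        rw [← hfab] at h6 h5
        nlinarith)
      rwa [← abs_neg (Real.sin _), ← Real.sin_neg, neg_sub] at this
  have hscont : Continuous s := by fun_prop
  have hden : ∀ ε : ℝ, 0 < ε → ∀ u, 0 < s u ^ 2 + ε := fun ε hε u => by positivity
  have step : ∀ ε : ℝ, 0 < ε →
      ∫ u in a..b, κ u * f u ^ 2 ≤ (∫ u in a..b, κ u * q u ^ 2) +
        ∫ u in a..b, κ u * (f u ^ 2 * ((ε + ε ^ 2) / (s u ^ 2 + ε) ^ 2)) := by
    intro ε hε
    set co : ℝ → ℝ := fun u => Real.cos (θ u - θ c) with hco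
    have hcocont : Continuous co := by fun_prop
    -- `φ` regularizes the cotangent and `dφ` is its derivative in the angle. The classical identity
    -- `1 + cot² + cot' = 0` acquires the right-hand side `(ε + ε²)/(s² + ε)²`.
    set φ : ℝ → ℝ := fun u => s u * co u / (s u ^ 2 + ε) with hφ
    set dφ : ℝ → ℝ := fun u =>
      ((co u ^ 2 - s u ^ 2) * (s u ^ 2 + ε) - 2 * s u ^ 2 * co u ^ 2) / (s u ^ 2 + ε) ^ 2 with hdφ
    have hφcont : Continuous φ := by
      refine (hscont.mul hcocont).div (by fun_prop) fun u => (hden ε hε u).ne'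
    have hdφcont : Continuous dφ := by
      refine Continuous.div (by fun_prop) (by fun_prop) fun u => pow_ne_zero _ (hden ε hε u).ne'
    have hderiv : ∀ u, HasDerivAt (fun u => f u ^ 2 * φ u)
        (κ u * (2 * f u * q u * φ u + f u ^ 2 * dφ u)) u := by
      intro u
      have h1 : HasDerivAt s (co u * κ u) u :=
        (Real.hasDerivAt_sin _).comp u ((hθ u).sub_const _)
      have h2 : HasDerivAt co (-s u * κ u) u :=
        (Real.hasDerivAt_cos _).comp u ((hθ u).sub_const _)
      have h3 := ((hf u).pow 2).mul ((h1.mul h2).div ((h1.pow 2).add_const ε) (hden ε hε u).ne')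
      refine h3.congr_deriv ?_
      have := (hden ε hε u).ne'
      simp only [hφ, hdφ]
      simp only [Pi.mul_apply, Pi.div_apply, Pi.pow_apply, Nat.cast_ofNat, Nat.add_one_sub_one, pow_one]
      field_simp
      ring
    have hint := intervalIntegral.integral_eq_sub_of_hasDerivAt (a := a) (b := b)
      (fun u _ => hderiv u) (by apply Continuous.intervalIntegrable; fun_prop)
    -- `φ` has period `π` in the angle, so the two boundary terms cancel.
    have hbdry : f b ^ 2 * φ b - f a ^ 2 * φ a = 0 := by
      have h1 : s b = - s a := by
        simp only [hs, hπ]; rw [add_sub_right_comm, Real.sin_add_pi]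
      have h2 : co b = - co a := by
        simp only [hco, hπ]; rw [add_sub_right_comm, Real.cos_add_pi]
      simp only [hφ, h1, h2, hfab]; ring
    rw [hbdry] at hint
    have hrcont : Continuous fun u => (ε + ε ^ 2) / (s u ^ 2 + ε) ^ 2 := by
      refine Continuous.div (by fun_prop) (by fun_prop) fun u => pow_ne_zero _ (hden ε hε u).ne'
    have hsum : ∀ u, κ u * q u ^ 2 + κ u * (f u ^ 2 * ((ε + ε ^ 2) / (s u ^ 2 + ε) ^ 2))
        - κ u * f u ^ 2 - κ u * (2 * f u * q u * φ u + f u ^ 2 * dφ u)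
        = κ u * (q u - f u * φ u) ^ 2 := by
      intro u
      have h1 : 1 + φ u ^ 2 + dφ u = (ε + ε ^ 2) / (s u ^ 2 + ε) ^ 2 := by
        have := (hden ε hε u).ne'
        have h2 : co u ^ 2 = 1 - s u ^ 2 := Real.cos_sq' _
        simp only [hφ, hdφ, div_pow, mul_pow, h2]
        field_simp
        ring
      rw [← h1]; ring
    have hnn : 0 ≤ ∫ u in a..b, κ u * (q u - f u * φ u) ^ 2 :=
      intervalIntegral.integral_nonneg hab fun u _ => mul_nonneg (hκ0 u) (sq_nonneg _)
    simp_rw [← hsum] at hnn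
    rw [intervalIntegral.integral_sub, intervalIntegral.integral_sub,
      intervalIntegral.integral_add, hint] at hnn
    · linarith
    all_goals apply Continuous.intervalIntegrable; fun_prop
  -- Dominated convergence: `f² ≤ C² s²` bounds the integrand by `κ C²` for `ε < 1`. Pointwise it
  -- tends to zero where `s ≠ 0`, and it is zero where `s = 0`, since `f` vanishes there too.
  have hlim : Tendsto (fun ε : ℝ =>
      ∫ u in a..b, κ u * (f u ^ 2 * ((ε + ε ^ 2) / (s u ^ 2 + ε) ^ 2))) (𝓝[>] 0) (𝓝 0) := by
    have h0 : ∫ u in a..b, (0 : ℝ) = 0 := by simp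
    nth_rewrite 3 [← h0]
    refine intervalIntegral.tendsto_integral_filter_of_dominated_convergence
      (fun u => κ u * C ^ 2) ?_ ?_ ?_ ?_
    · filter_upwards [self_mem_nhdsWithin] with ε hε
      refine (Continuous.aestronglyMeasurable ?_)
      refine hκ.mul ((hfcont.pow 2).mul (Continuous.div (by fun_prop) (by fun_prop)
        fun u => pow_ne_zero _ (hden ε hε u).ne'))
    · have h1 : ∀ᶠ ε : ℝ in 𝓝[>] 0, ε < 1 :=
        nhdsWithin_le_nhds (Iio_mem_nhds one_pos)
      filter_upwards [self_mem_nhdsWithin, h1] with ε hε hε1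
      refine Eventually.of_forall fun u hu => ?_
      rw [uIoc_of_le hab] at hu
      have h2 := hbound u ⟨hu.1.le, hu.2⟩
      have hε : 0 < ε := hε
      have h3 : f u ^ 2 ≤ C ^ 2 * s u ^ 2 := by
        rw [← sq_abs (f u), ← sq_abs (s u), ← mul_pow]; gcongr
      have h4 := hden ε hε u
      rw [Real.norm_of_nonneg (mul_nonneg (hκ0 u) (by positivity))]
      refine mul_le_mul_of_nonneg_left ?_ (hκ0 u)
      rw [mul_div_assoc', div_le_iff₀ (by positivity)]
      calc f u ^ 2 * (ε + ε ^ 2) ≤ C ^ 2 * s u ^ 2 * (2 * ε) := by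
            gcongr; nlinarith
        _ ≤ C ^ 2 * (s u ^ 2 + ε) ^ 2 := by
            rw [mul_assoc]; gcongr; nlinarith [sq_nonneg (s u ^ 2), sq_nonneg ε]
    · apply Continuous.intervalIntegrable; fun_prop
    · refine Eventually.of_forall fun u hu => ?_
      rw [uIoc_of_le hab] at hu
      have h2 := hbound u ⟨hu.1.le, hu.2⟩
      by_cases hsu : s u = 0
      · rw [hsu, abs_zero, mul_zero] at h2
        have : f u = 0 := abs_nonpos_iff.1 h2
        simp [this]
      · have : ContinuousAt (fun ε : ℝ =>
            κ u * (f u ^ 2 * ((ε + ε ^ 2) / (s u ^ 2 + ε) ^ 2))) 0 := by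
          have : (s u ^ 2 + 0) ^ 2 ≠ 0 := by simpa using hsu
          fun_prop (disch := assumption)
        have h5 := this.tendsto
        simp only [ne_eq, OfNat.ofNat_ne_zero, not_false_eq_true, zero_pow, add_zero, zero_div,
          mul_zero] at h5
        exact h5.mono_left nhdsWithin_le_nhds
  have := hlim.const_add (∫ u in a..b, κ u * q u ^ 2)
  rw [add_zero] at this
  exact ge_of_tendsto this (by filter_upwards [self_mem_nhdsWithin] with ε hε using step ε hε)

/-! ### Area, and the isoperimetric inequality -/

theorem continuous_det {X : Type*} [TopologicalSpace X] {f g : X → ℂ} (hf : Continuous f)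
    (hg : Continuous g) : Continuous fun t => det (f t) (g t) := by
  unfold det; fun_prop

theorem det_mul_mul (w a b : ℂ) : det (w * a) (w * b) = ‖w‖ ^ 2 * det a b := by
  rw [Complex.sq_norm, Complex.normSq_apply]; simp [det]; ring

theorem det_sub_left (a b c : ℂ) : det (a - b) c = det a c - det b c := by simp [det]; ring

theorem integral_det_const {x x' : ℝ → ℂ} (hx : ∀ u, HasDerivAt x (x' u) u) (hx' : Continuous x')
    (c : ℂ) (a b : ℝ) : ∫ u in a..b, det c (x' u) = det c (x b - x a) := by
  have h : ∀ u, HasDerivAt (fun u => det c (x u)) (det c (x' u)) u := by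
    intro u
    have h1 := Complex.reCLM.hasFDerivAt.comp_hasDerivAt u (hx u)
    have h2 := Complex.imCLM.hasFDerivAt.comp_hasDerivAt u (hx u)
    exact (h2.const_mul c.re).sub (h1.const_mul c.im)
  rw [intervalIntegral.integral_eq_sub_of_hasDerivAt (fun u _ => h u)
    ((continuous_det continuous_const hx').intervalIntegrable _ _)]
  simp [det]; ring

theorem area_eq_integral_sub {x x' : ℝ → ℂ} (hx : ∀ u, HasDerivAt x (x' u) u)
    (hx' : Continuous x') (hper : Function.Periodic x 1) (c : ℂ) :
    area x = 1 / 2 * ∫ u in (0 : ℝ)..1, det (x u - c) (x' u) := by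
  have hxc : Continuous x := continuous_iff_continuousAt.2 fun u => (hx u).continuousAt
  have : deriv x = x' := funext fun u => (hx u).deriv
  rw [area, this]
  simp_rw [det_sub_left]
  rw [intervalIntegral.integral_sub ((continuous_det hxc hx').intervalIntegrable _ _)
    ((continuous_det continuous_const hx').intervalIntegrable _ _),
    integral_det_const hx hx']
  have := hper 0
  simp only [zero_add] at this
  simp [this, det]

theorem length_eq_integral (x : ℝ → ℂ) : length x = ∫ u in (0 : ℝ)..1, speed x u := by
  simp [length, curveIntegral]

theorem exists_norm_eq_one_mul_im_eq_zero (z : ℂ) : ∃ w : ℂ, ‖w‖ = 1 ∧ (w * z).im = 0 := by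
  refine ⟨Complex.exp (-(z.arg) * Complex.I), ?_, ?_⟩
  · rw [← Complex.ofReal_neg, Complex.norm_exp_ofReal_mul_I]
  · conv_lhs => rw [← Complex.norm_mul_exp_arg_mul_I z]
    rw [mul_left_comm, ← Complex.exp_add]
    simp

/-- The curve is cut into two halves of equal length and rotated so that the cutting chord is
horizontal. The height above the chord then vanishes at both ends of each half, where the angle `2π
S/ℓ` advances by `π`, so the Wirtinger inequality applies to each. What remains is a pointwise
completed square. The area is signed; neither convexity nor simplicity enters. -/
theorem isoperimetric_inequality {x : ℝ → ℂ} (hx : ContDiff ℝ 1 x) (hper : Function.Periodic x 1)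
    (hreg : ∀ u, deriv x u ≠ 0) : 4 * Real.pi * area x ≤ length x ^ 2 := by
  have hpi := Real.pi_pos
  have hd : ∀ u, HasDerivAt x (deriv x u) u := fun u =>
    (hx.differentiable (by norm_num) u).hasDerivAt
  have hdc : Continuous (deriv x) := hx.continuous_deriv le_rfl
  set g : ℝ → ℝ := speed x with hg
  have hgc : Continuous g := hdc.norm
  have hg0 : ∀ u, 0 < g u := fun u => norm_pos_iff.2 (hreg u)
  set S : ℝ → ℝ := fun u => ∫ v in (0 : ℝ)..u, g v with hS
  have hSd : ∀ u, HasDerivAt S (g u) u := fun u =>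
    intervalIntegral.integral_hasDerivAt_right (hgc.intervalIntegrable _ _)
      hgc.stronglyMeasurable.stronglyMeasurableAtFilter hgc.continuousAt
  have hS1 : S 1 = length x := (length_eq_integral x).symm
  have hS0 : S 0 = 0 := by simp [hS]
  set ℓ := length x with hℓ
  have hℓ0 : 0 < ℓ := by
    rw [hℓ, length_eq_integral]
    exact intervalIntegral.intervalIntegral_pos_of_pos (hgc.intervalIntegrable _ _) hg0 one_pos
  obtain ⟨m, hm, hSm⟩ : ∃ m ∈ Icc (0 : ℝ) 1, S m = ℓ / 2 := by
    have := intermediate_value_Icc (zero_le_one' ℝ)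
      (f := S) (fun u _ => (hSd u).continuousAt.continuousWithinAt)
    exact this ⟨by rw [hS0]; positivity, by rw [hS1]; linarith⟩
  obtain ⟨w, hw, hwim⟩ := exists_norm_eq_one_mul_im_eq_zero (x m - x 0)
  set z : ℝ → ℂ := fun u => w * (x u - x 0) with hz
  set z' : ℝ → ℂ := fun u => w * deriv x u with hz'
  have hzd : ∀ u, HasDerivAt z (z' u) u := fun u => ((hd u).sub_const _).const_mul w
  have hzc : Continuous z := continuous_iff_continuousAt.2 fun u => (hzd u).continuousAt
  have hz'c : Continuous z' := by fun_prop
  have hre : ∀ u, HasDerivAt (fun u => (z u).re) (z' u).re u := fun u =>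
    Complex.reCLM.hasFDerivAt.comp_hasDerivAt u (hzd u)
  have him : ∀ u, HasDerivAt (fun u => (z u).im) (z' u).im u := fun u =>
    Complex.imCLM.hasFDerivAt.comp_hasDerivAt u (hzd u)
  have hz0 : z 0 = 0 := by simp [hz]
  have hz1 : z 1 = 0 := by have := hper 0; simp only [zero_add] at this; simp [hz, this]
  have hA : area x = - ∫ u in (0 : ℝ)..1, (z u).im * (z' u).re := by
    have h1 : ∀ u, det (x u - x 0) (deriv x u) =
        ((z' u).re * (z u).im + (z u).re * (z' u).im) - 2 * ((z u).im * (z' u).re) := by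
      intro u
      have := det_mul_mul w (x u - x 0) (deriv x u)
      rw [hw] at this
      simp only [one_pow, one_mul] at this
      rw [← this]; simp only [det, hz, hz']; ring
    rw [area_eq_integral_sub hd hdc hper (x 0)]
    simp_rw [h1]
    rw [intervalIntegral.integral_sub, intervalIntegral.integral_const_mul,
      intervalIntegral.integral_eq_sub_of_hasDerivAt (fun u _ => (hre u).mul (him u))]
    · simp [hz0, hz1]
    all_goals apply Continuous.intervalIntegrable; fun_prop
  set κ : ℝ → ℝ := fun u => 2 * Real.pi / ℓ * g u with hκ
  have hκ0 : ∀ u, 0 < κ u := fun u => by have := hg0 u; positivity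
  have hκc : Continuous κ := by fun_prop
  set q : ℝ → ℝ := fun u => (z' u).im / κ u with hq
  have hqc : Continuous q := by
    exact Continuous.div (by fun_prop) hκc fun u => (hκ0 u).ne'
  have hθ : ∀ u, HasDerivAt (fun u => 2 * Real.pi / ℓ * S u) (κ u) u := fun u =>
    (hSd u).const_mul _
  have hf : ∀ u, HasDerivAt (fun u => (z u).im) (κ u * q u) u := fun u => by
    have := (hκ0 u).ne'
    refine (him u).congr_deriv ?_
    simp only [hq]; field_simp
  have w1 := integral_mul_sq_le_integral_mul_sq_of_eq_zero (a := 0) (b := m) (c := 0) hθ hf hκc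
    (fun u => (hκ0 u).le) hqc (by simp only [hS0, hSm]; field_simp; ring)
    (by simp only [hz0]; simp only [hz, hwim]; simp) ⟨le_rfl, hm.1⟩ (by simp [hz0])
  have w2 := integral_mul_sq_le_integral_mul_sq_of_eq_zero (a := m) (b := 1) (c := 1) hθ hf hκc
    (fun u => (hκ0 u).le) hqc (by simp only [hS1, hSm]; field_simp; ring)
    (by simp only [hz1]; simp only [hz, hwim]; simp) ⟨hm.2, le_rfl⟩ (by simp [hz1])
  have w3 : ∫ u in (0 : ℝ)..1, κ u * (z u).im ^ 2 ≤ ∫ u in (0 : ℝ)..1, κ u * q u ^ 2 := by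
    rw [← intervalIntegral.integral_add_adjacent_intervals (a := 0) (b := m) (c := 1),
      ← intervalIntegral.integral_add_adjacent_intervals (a := 0) (b := m) (c := 1)
        (f := fun u => κ u * q u ^ 2)]
    · linarith
    all_goals apply Continuous.intervalIntegrable; fun_prop
  -- By `|z'| = g`, this sum equals `(κ Im z + Re z')² / κ`.
  have pt : ∀ u, 0 ≤ (κ u * (z u).im ^ 2 - κ u * q u ^ 2 + ℓ / (2 * Real.pi) * g u)
      + 2 * ((z u).im * (z' u).re) := by
    intro u
    have h1 : (z' u).re ^ 2 + (z' u).im ^ 2 = g u ^ 2 := by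
      have : ‖z' u‖ = g u := by simp [hz', hw, hg, speed]
      rw [← this, Complex.sq_norm, Complex.normSq_apply]; ring
    have h2 : ℓ / (2 * Real.pi) * g u = g u ^ 2 / κ u := by
      have := (hg0 u).ne'
      simp only [hκ]; field_simp
    have h3 : κ u * q u ^ 2 = (z' u).im ^ 2 / κ u := by
      have := (hκ0 u).ne'
      simp only [hq]; field_simp
    have h4 : κ u * (z u).im ^ 2 - κ u * q u ^ 2 + ℓ / (2 * Real.pi) * g u
      + 2 * ((z u).im * (z' u).re) = (κ u * (z u).im + (z' u).re) ^ 2 / κ u := by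
      have := (hκ0 u).ne'
      rw [h2, h3, ← h1]; field_simp; ring
    rw [h4]
    have := hκ0 u
    positivity
  have hnn := intervalIntegral.integral_nonneg (μ := volume) (zero_le_one' ℝ) fun u _ => pt u
  rw [intervalIntegral.integral_add, intervalIntegral.integral_add, intervalIntegral.integral_sub,
    intervalIntegral.integral_const_mul, intervalIntegral.integral_const_mul,
    ← length_eq_integral] at hnn
  · have h5 : 2 * area x ≤ ℓ / (2 * Real.pi) * ℓ := by rw [hA]; linarith
    have h6 : ℓ / (2 * Real.pi) * ℓ = ℓ ^ 2 / (2 * Real.pi) := by ring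
    rw [h6, le_div_iff₀ (by positivity)] at h5
    linarith
  all_goals apply Continuous.intervalIntegrable; fun_prop

/-! ### Gage's inequality -/

/-- The support function `-(x - c) · N` of a curve with tangent angle `θ`, with respect to the
origin `c`. -/
noncomputable def supportFn (x : ℝ → ℂ) (θ : ℝ → ℝ) (c : ℂ) (u : ℝ) : ℝ :=
  (x u - c).re * Real.sin (θ u) - (x u - c).im * Real.cos (θ u)

/-- The tangential component `(x - c) · T` of a curve with tangent angle `θ`. -/
noncomputable def tangentialFn (x : ℝ → ℂ) (θ : ℝ → ℝ) (c : ℂ) (u : ℝ) : ℝ :=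
  (x u - c).re * Real.cos (θ u) + (x u - c).im * Real.sin (θ u)

/-- `x` has speed `g`, tangent angle `θ`, and `θ' = κ`. -/
structure HasAngle (x : ℝ → ℂ) (g κ θ : ℝ → ℝ) : Prop where
  curve : ∀ u, HasDerivAt x (g u * Complex.exp (θ u * Complex.I)) u
  angle : ∀ u, HasDerivAt θ (κ u) u
  speed_cont : Continuous g
  curv_cont : Continuous κ
  speed_pos : ∀ u, 0 < g u

namespace HasAngle

variable {x : ℝ → ℂ} {g κ θ : ℝ → ℝ}

theorem angle_cont (h : HasAngle x g κ θ) : Continuous θ :=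
  continuous_iff_continuousAt.2 fun u => (h.angle u).continuousAt

theorem curve_cont (h : HasAngle x g κ θ) : Continuous x :=
  continuous_iff_continuousAt.2 fun u => (h.curve u).continuousAt

theorem deriv_curve_cont (h : HasAngle x g κ θ) :
    Continuous fun u => (g u * Complex.exp (θ u * Complex.I) : ℂ) := by
  have := h.angle_cont; have := h.speed_cont
  fun_prop

theorem re_deriv (h : HasAngle x g κ θ) (u : ℝ) :
    HasDerivAt (fun u => (x u).re) (g u * Real.cos (θ u)) u := by
  refine (Complex.reCLM.hasFDerivAt.comp_hasDerivAt u (h.curve u)).congr_deriv ?_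
  simp [Complex.exp_ofReal_mul_I_re]

theorem im_deriv (h : HasAngle x g κ θ) (u : ℝ) :
    HasDerivAt (fun u => (x u).im) (g u * Real.sin (θ u)) u := by
  refine (Complex.imCLM.hasFDerivAt.comp_hasDerivAt u (h.curve u)).congr_deriv ?_
  simp [Complex.exp_ofReal_mul_I_im]

theorem support_cont (h : HasAngle x g κ θ) (c : ℂ) : Continuous (supportFn x θ c) := by
  have := h.angle_cont; have := h.curve_cont
  unfold supportFn; fun_prop

theorem tangential_cont (h : HasAngle x g κ θ) (c : ℂ) : Continuous (tangentialFn x θ c) := by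
  have := h.angle_cont; have := h.curve_cont
  unfold tangentialFn; fun_prop

theorem support_deriv (h : HasAngle x g κ θ) (c : ℂ) (u : ℝ) :
    HasDerivAt (supportFn x θ c) (κ u * tangentialFn x θ c u) u := by
  have h1 := ((h.re_deriv u).sub_const c.re).mul (h.angle u).sin
  have h2 := ((h.im_deriv u).sub_const c.im).mul (h.angle u).cos
  refine (h1.sub h2).congr_deriv ?_
  simp only [tangentialFn, Complex.sub_re, Complex.sub_im]; ring

theorem tangential_deriv (h : HasAngle x g κ θ) (c : ℂ) (u : ℝ) :
    HasDerivAt (tangentialFn x θ c) (g u - κ u * supportFn x θ c u) u := by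
  have h1 := ((h.re_deriv u).sub_const c.re).mul (h.angle u).cos
  have h2 := ((h.im_deriv u).sub_const c.im).mul (h.angle u).sin
  refine (h1.add h2).congr_deriv ?_
  have := Real.sin_sq_add_cos_sq (θ u)
  simp only [supportFn, Complex.sub_re, Complex.sub_im]
  linear_combination g u * this

theorem det_eq (c : ℂ) (u : ℝ) :
    det (x u - c) (g u * Complex.exp (θ u * Complex.I)) = supportFn x θ c u * g u := by
  simp [det, supportFn, Complex.exp_ofReal_mul_I_re, Complex.exp_ofReal_mul_I_im]; ring

theorem area_eq (h : HasAngle x g κ θ) (hper : Function.Periodic x 1) (c : ℂ) :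
    area x = 1 / 2 * ∫ u in (0 : ℝ)..1, supportFn x θ c u * g u := by
  rw [area_eq_integral_sub h.curve h.deriv_curve_cont hper c]
  simp_rw [det_eq]

theorem angle_mono (h : HasAngle x g κ θ) (hκ : ∀ u, 0 ≤ κ u) : Monotone θ :=
  monotone_of_deriv_nonneg (fun u => (h.angle u).differentiableAt)
    fun u => by rw [(h.angle u).deriv]; exact hκ u

/-- Bonnesen's inequality for one half of a centrally symmetric convex curve. -/
theorem bonnesen_half (h : HasAngle x g κ θ) (hκ : ∀ u, 0 ≤ κ u) {c : ℂ} {a b : ℝ}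
    (hθ : θ b = θ a + Real.pi) (hx : x b - c = -(x a - c)) {v : ℝ} (hv : v ∈ Icc a b) :
    (∫ u in a..b, supportFn x θ c u * g u) - 2 * supportFn x θ c v * (∫ u in a..b, g u)
      + Real.pi * supportFn x θ c v ^ 2 ≤ 0 := by
  set p := supportFn x θ c with hp
  set q := tangentialFn x θ c with hq
  have hpc : Continuous p := h.support_cont c
  have hqc : Continuous q := h.tangential_cont c
  have hgc := h.speed_cont
  have hκc := h.curv_cont
  have hpc' := h.support_cont c
  have hqc' := h.tangential_cont c
  have hpab : p b = p a := by
    simp only [hp, supportFn, hx, hθ, Real.sin_add_pi, Real.cos_add_pi, Complex.neg_re, Complex.neg_im]; ring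
  have hqab : q b = q a := by
    simp only [hq, tangentialFn, hx, hθ, Real.sin_add_pi, Real.cos_add_pi, Complex.neg_re, Complex.neg_im]; ring
  -- `p - p v` vanishes at `v`, and its end values agree because both the position relative to `c`
  -- and the tangent are reversed from `a` to `b`.
  have w := integral_mul_sq_le_integral_mul_sq_of_eq_zero (f := fun u => p u - p v) h.angle
    (fun u => (h.support_deriv c u).sub_const _) hκc hκ hqc hθ
    (by simp only [hpab]) hv (sub_self _)
  have i1 : ∫ u in a..b, κ u = Real.pi := by
    rw [intervalIntegral.integral_eq_sub_of_hasDerivAt (fun u _ => h.angle u)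
      (hκc.intervalIntegrable _ _), hθ]; ring
  have i2 : ∫ u in a..b, (g u - κ u * p u) = 0 := by
    rw [intervalIntegral.integral_eq_sub_of_hasDerivAt (fun u _ => h.tangential_deriv c u)
      (by apply Continuous.intervalIntegrable; fun_prop)]
    change q b - q a = 0
    rw [hqab, sub_self]
  have i3 : ∫ u in a..b, (κ u * q u * q u + p u * (g u - κ u * p u)) = 0 := by
    rw [intervalIntegral.integral_eq_sub_of_hasDerivAt
      (fun u _ => (h.support_deriv c u).mul (h.tangential_deriv c u))
      (by apply Continuous.intervalIntegrable; fun_prop)]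
    change p b * q b - p a * q a = 0
    rw [hqab, hpab, sub_self]
  -- The brackets `g - κ p` and `κ q² + p (g - κ p)` are the derivatives of `q` and `p q`. They
  -- integrate to zero and leave only the integrals of `p g`, `g` and `κ`.
  have e : ∀ u, κ u * (p u - p v) ^ 2 = κ u * q u ^ 2
      - (κ u * q u * q u + p u * (g u - κ u * p u)) + p u * g u
      + 2 * p v * (g u - κ u * p u) - 2 * p v * g u + p v ^ 2 * κ u := by intro u; ring
  simp_rw [e] at w
  rw [intervalIntegral.integral_add, intervalIntegral.integral_sub, intervalIntegral.integral_add,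
    intervalIntegral.integral_add, intervalIntegral.integral_sub,
    intervalIntegral.integral_const_mul, intervalIntegral.integral_const_mul,
    intervalIntegral.integral_const_mul, i1, i2, i3] at w
  · linarith
  all_goals apply Continuous.intervalIntegrable; fun_prop

/-- Bonnesen's inequality holds at every `v`, so it may be integrated over the arc with weight `g
v`. In the case of equality `p` takes its values among the roots of one quadratic polynomial, hence
is constant by continuity. -/
theorem gage_half (h : HasAngle x g κ θ) (hκ : ∀ u, 0 ≤ κ u) {c : ℂ} {a b : ℝ} (hab : a < b)
    (hθ : θ b = θ a + Real.pi) (hx : x b - c = -(x a - c)) :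
    Real.pi * (∫ u in a..b, supportFn x θ c u ^ 2 * g u) ≤
      (∫ u in a..b, supportFn x θ c u * g u) * (∫ u in a..b, g u) ∧
    (Real.pi * (∫ u in a..b, supportFn x θ c u ^ 2 * g u) <
      (∫ u in a..b, supportFn x θ c u * g u) * (∫ u in a..b, g u) ∨
      ∀ u ∈ Icc a b, supportFn x θ c u = supportFn x θ c a) := by
  have hB := fun v (hv : v ∈ Icc a b) => h.bonnesen_half hκ hθ hx hv
  set p := supportFn x θ c with hp
  set A := ∫ u in a..b, p u * g u with hA
  set ℓ := ∫ u in a..b, g u with hℓ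
  have hpc : Continuous p := h.support_cont c
  have hgc := h.speed_cont
  set F : ℝ → ℝ := fun v => -((A - 2 * p v * ℓ + Real.pi * p v ^ 2) * g v) with hF
  have hFc : Continuous F := by fun_prop
  have hF0 : ∀ v ∈ Icc a b, 0 ≤ F v := fun v hv => by
    have h1 := hB v hv
    have h2 := h.speed_pos v
    simp only [hF]; nlinarith
  have hFint : ∫ u in a..b, F u = A * ℓ - Real.pi * ∫ u in a..b, p u ^ 2 * g u := by
    have e : ∀ u, F u = 2 * ℓ * (p u * g u) - A * g u - Real.pi * (p u ^ 2 * g u) := by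
      intro u; simp only [hF]; ring
    simp_rw [e]
    rw [intervalIntegral.integral_sub, intervalIntegral.integral_sub,
      intervalIntegral.integral_const_mul, intervalIntegral.integral_const_mul,
      intervalIntegral.integral_const_mul]
    · ring
    all_goals apply Continuous.intervalIntegrable; fun_prop
  have hle := intervalIntegral.integral_nonneg (μ := volume) hab.le hF0
  refine ⟨by linarith, ?_⟩
  by_cases hz : ∀ u ∈ Icc a b, F u = 0
  · right
    have hroot : ∀ u ∈ Icc a b, A - 2 * p u * ℓ + Real.pi * p u ^ 2 = 0 := fun u hu => by
      have h1 := hz u hu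
      have h2 := (h.speed_pos u).ne'
      simp only [hF, neg_eq_zero, mul_eq_zero, h2, or_false] at h1
      exact h1
    intro u hu
    have ha : a ∈ Icc a b := ⟨le_rfl, hab.le⟩
    by_contra hne
    -- If two values of `p` differed, their midpoint would also be a value, and a quadratic with
    -- leading coefficient `π` cannot vanish at all three.
    obtain ⟨w, hw, hpw⟩ : ∃ w ∈ Icc a b, p w = (p a + p u) / 2 := by
      have := intermediate_value_uIcc (a := a) (b := u) hpc.continuousOn
      obtain ⟨w, hw, hw2⟩ := this (show (p a + p u) / 2 ∈ uIcc (p a) (p u) by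
        rw [mem_uIcc]
        rcases le_total (p a) (p u) with h | h
        · left; constructor <;> linarith
        · right; constructor <;> linarith)
      rw [uIcc_of_le hu.1] at hw
      exact ⟨w, ⟨hw.1, hw.2.trans hu.2⟩, hw2⟩
    have r1 := hroot a ha
    have r2 := hroot u hu
    have r3 := hroot w hw
    rw [hpw] at r3
    have : Real.pi * (p u - p a) ^ 2 = 0 := by linear_combination 2 * r1 + 2 * r2 - 4 * r3
    simp only [mul_eq_zero, Real.pi_ne_zero, false_or, ne_eq, OfNat.ofNat_ne_zero,
      not_false_eq_true, pow_eq_zero_iff] at this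
    exact hne (sub_eq_zero.1 this)
  · left
    push Not at hz
    obtain ⟨u, hu, hFu⟩ := hz
    have : 0 < ∫ u in a..b, F u :=
      intervalIntegral.integral_pos hab hFc.continuousOn
        (fun v hv => hF0 v ⟨hv.1.le, hv.2⟩) ⟨u, hu, lt_of_le_of_ne (hF0 u hu) (Ne.symm hFu)⟩
    linarith

/-- A closed convex curve has a chord with opposite tangents at its ends that bisects its area. -/
theorem exists_bisecting_chord (h : HasAngle x g κ θ) (hκ : ∀ u, 0 ≤ κ u)
    (hper : Function.Periodic x 1) (hθ1 : ∀ u, θ (u + 1) = θ u + 2 * Real.pi) :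
    ∃ a b c, a < b ∧ b < a + 1 ∧ θ b = θ a + Real.pi ∧ x b - c = -(x a - c) ∧
      ∫ u in a..b, supportFn x θ c u * g u = ∫ u in b..(a + 1), supportFn x θ c u * g u := by
  have hpi := Real.pi_pos
  have hxc := h.curve_cont
  have hθc := h.angle_cont
  have hmono := h.angle_mono hκ
  set x' : ℝ → ℂ := fun u => g u * Complex.exp (θ u * Complex.I) with hx'
  have hx'c : Continuous x' := h.deriv_curve_cont
  have hdc : Continuous fun u => det (x u) (x' u) := continuous_det hxc hx'c
  set J : ℝ → ℝ := fun u => ∫ v in (0 : ℝ)..u, det (x v) (x' v) with hJ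
  have hJc : Continuous J := intervalIntegral.continuous_primitive
    (fun a b => hdc.intervalIntegrable a b) 0
  have hJint : ∀ u v, ∫ w in u..v, det (x w) (x' w) = J v - J u := fun u v =>
    (intervalIntegral.integral_interval_sub_left (hdc.intervalIntegrable _ _)
      (hdc.intervalIntegrable _ _)).symm
  have hgper : Function.Periodic (fun u => det (x u) (x' u)) 1 := by
    have e : x' = deriv x := funext fun u => (h.curve u).deriv.symm
    have : Function.Periodic (deriv x) 1 := by
      intro u
      have : (fun v => x (v + 1)) = x := funext hper
      rw [← deriv_comp_add_const, this]
    intro u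
    simp only [e, hper u, this u]
  -- Twice the signed area between the arc from `u` to `v` and its chord.
  set E : ℝ → ℝ → ℝ := fun u v => J v - J u - det (x u) (x v) with hE
  have hEper : ∀ u v, E (u + 1) (v + 1) = E u v := by
    intro u v
    have : J (v + 1) - J (u + 1) = J v - J u := by
      rw [← hJint, ← hJint, ← intervalIntegral.integral_comp_add_right
        (fun w => det (x w) (x' w))]
      simp_rw [hgper _]
    simp only [hE, this, hper u, hper v]
  set Φ : ℝ × ℝ → ℝ := fun z => |E z.1 z.2 - E z.2 (z.1 + 1)| + |θ z.2 - θ z.1 - Real.pi| with hΦ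
  have hΦc : Continuous Φ := by
    have d1 : Continuous fun z : ℝ × ℝ => det (x z.1) (x z.2) :=
      continuous_det (by fun_prop) (by fun_prop)
    have d2 : Continuous fun z : ℝ × ℝ => det (x z.2) (x (z.1 + 1)) :=
      continuous_det (by fun_prop) (by fun_prop)
    simp only [hΦ, hE]
    fun_prop
  set K : Set (ℝ × ℝ) := (Icc 0 1 ×ˢ Icc 0 2) ∩ {z | z.1 ≤ z.2 ∧ z.2 ≤ z.1 + 1} with hK
  have hKc : IsCompact K := by
    refine (isCompact_Icc.prod isCompact_Icc).inter_right ?_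
    exact (isClosed_le continuous_fst continuous_snd).inter
      (isClosed_le continuous_snd (continuous_fst.add continuous_const))
  -- Where `θ` is constant on an interval, the point with the opposite tangent is not unique. Adding
  -- `ε u` makes the angle strictly increasing, so half a turn (now `π + ε / 2`) defines a
  -- continuous antipodal map `τ` with `τ (τ u) = u + 1`. The area difference `D` changes sign
  -- between `0` and `τ 0`, hence has a zero. The perturbation costs at most `ε` in `Φ`, and
  -- compactness of `K` then yields an exact zero of `Φ`.
  have approx : ∀ ε : ℝ, 0 < ε → ∃ z ∈ K, Φ z ≤ ε := by
    intro ε hε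
    have hsm : StrictMono fun u => θ u + ε * u := fun u v huv => by
      have := hmono huv.le
      simp only; nlinarith
    have hsurj : Function.Surjective fun u => θ u + ε * u := by
      refine Continuous.surjective (by fun_prop) ?_ ?_
      · refine tendsto_atTop_mono' _ (f₁ := fun u => θ 0 + ε * u) ?_
          (tendsto_atTop_add_const_left _ _ (tendsto_id.const_mul_atTop hε))
        filter_upwards [eventually_ge_atTop 0] with u hu
        have := hmono hu
        linarith
      · refine tendsto_atBot_mono' _ (f₁ := fun u => θ 0 + ε * u) ?_
          (tendsto_atBot_add_const_left _ _ (tendsto_id.const_mul_atBot hε))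
        filter_upwards [eventually_le_atBot 0] with u hu
        have := hmono hu
        linarith
    set e : ℝ ≃o ℝ := hsm.orderIsoOfSurjective _ hsurj with he
    have hev : ∀ u, e u = θ u + ε * u := fun u => rfl
    have he1 : ∀ u, e (u + 1) = e u + 2 * Real.pi + ε := fun u => by
      simp only [hev, hθ1]; ring
    set τ : ℝ → ℝ := fun u => e.symm (e u + Real.pi + ε / 2) with hτ
    have hτc : Continuous τ := by
      have := e.continuous; have := e.symm.continuous
      fun_prop
    have heτ : ∀ u, e (τ u) = e u + Real.pi + ε / 2 := fun u => e.apply_symm_apply _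
    have hττ : ∀ u, τ (τ u) = u + 1 := fun u => by
      apply e.injective
      rw [heτ, heτ, he1]; ring
    have hτlt : ∀ u, u < τ u := fun u => by
      rw [← e.lt_iff_lt, heτ]; linarith
    have hτle : ∀ u, τ u ≤ u + 1 := fun u => by
      rw [← hττ]; exact (hτlt _).le
    set D : ℝ → ℝ := fun u => E u (τ u) - E (τ u) (u + 1) with hD
    have hDc : Continuous D := by
      have d1 : Continuous fun u : ℝ => det (x u) (x (τ u)) :=
        continuous_det (by fun_prop) (by fun_prop)
      have d2 : Continuous fun u : ℝ => det (x (τ u)) (x (u + 1)) :=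
        continuous_det (by fun_prop) (by fun_prop)
      simp only [hD, hE]
      fun_prop
    have hDτ : D (τ 0) = - D 0 := by
      simp only [hD, hττ]
      rw [hEper]; ring
    obtain ⟨u, hu, hDu⟩ : ∃ u ∈ Icc 0 (τ 0), D u = 0 := by
      have := intermediate_value_uIcc (a := 0) (b := τ 0) hDc.continuousOn
      obtain ⟨w, hw, hw2⟩ := this (show (0 : ℝ) ∈ uIcc (D 0) (D (τ 0)) by
        rw [mem_uIcc, hDτ]
        rcases le_total (D 0) 0 with h | h
        · left; constructor <;> linarith
        · right; constructor <;> linarith)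
      rw [uIcc_of_le (hτlt 0).le] at hw
      exact ⟨w, hw, hw2⟩
    have hu1 : u ≤ 1 := hu.2.trans (by simpa using hτle 0)
    refine ⟨(u, τ u), ⟨⟨⟨hu.1, hu1⟩, ⟨hu.1.trans (hτlt u).le, by linarith [hτle u]⟩⟩,
      ⟨(hτlt u).le, hτle u⟩⟩, ?_⟩
    have h1 := heτ u
    simp only [hev] at h1
    have h2 : θ (τ u) - θ u - Real.pi = ε / 2 - ε * (τ u - u) := by linear_combination h1
    have h3 : |θ (τ u) - θ u - Real.pi| ≤ ε := by
      rw [h2, abs_le]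
      have := hτlt u
      have := hτle u
      constructor <;> nlinarith
    simp only [hD] at hDu
    simp only [hΦ, hDu, abs_zero, zero_add]
    exact h3
  obtain ⟨z, hz, hmin⟩ := hKc.exists_isMinOn
    (by obtain ⟨z, hz, -⟩ := approx 1 one_pos; exact ⟨z, hz⟩) hΦc.continuousOn
  have hΦz : Φ z ≤ 0 := by
    refine le_of_forall_pos_le_add fun ε hε => ?_
    obtain ⟨y, hy, hy2⟩ := approx ε hε
    rw [zero_add]
    exact (hmin hy).trans hy2
  obtain ⟨a, b⟩ := z
  simp only [hΦ] at hΦz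
  have z1 : E a b - E b (a + 1) = 0 := by
    rw [← abs_nonpos_iff]; linarith [abs_nonneg (θ b - θ a - Real.pi)]
  have z2 : θ b - θ a - Real.pi = 0 := by
    rw [← abs_nonpos_iff]; linarith [abs_nonneg (E a b - E b (a + 1))]
  refine ⟨a, b, (x a + x b) / 2, ?_, ?_, by linarith, by ring, ?_⟩
  · refine lt_of_le_of_ne hz.2.1 fun hab => ?_
    replace hab : _ = _ := hab
    rw [hab] at z2; linarith
  · refine lt_of_le_of_ne hz.2.2 fun hab => ?_
    replace hab : _ = _ := hab
    rw [hab, hθ1] at z2; linarith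
  -- The integral of `p g` is twice the area swept out from `c`; as `c` lies on the chord, this is
  -- the area between arc and chord.
  · have key : ∀ u v c, c = (x u + x v) / 2 →
        ∫ w in u..v, supportFn x θ c w * g w = E u v := by
      intro u v c hc
      simp_rw [← det_eq, det_sub_left]
      rw [intervalIntegral.integral_sub (hdc.intervalIntegrable _ _)
        ((continuous_det continuous_const hx'c).intervalIntegrable _ _),
        integral_det_const h.curve hx'c, hJint, hE, hc]
      simp [det]; ring
    rw [key a b _ rfl, key b (a + 1) _ (by rw [hper]; ring)]
    linarith

theorem supportFn_periodic (hper : Function.Periodic x 1)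
    (hθ1 : ∀ u, θ (u + 1) = θ u + 2 * Real.pi) (c : ℂ) : Function.Periodic (supportFn x θ c) 1 := by
  intro u
  simp only [supportFn, hper u, hθ1, Real.sin_add_two_pi, Real.cos_add_two_pi]

/-- The center is the midpoint of a bisecting chord. The integral of `p g` over each arc is then the
full `area x`, so the two half inequalities add up. In the case of equality `p` is constant on both
arcs, which share an endpoint. -/
theorem exists_center_integral_sq_le (h : HasAngle x g κ θ) (hκ : ∀ u, 0 ≤ κ u)
    (hper : Function.Periodic x 1) (hgper : Function.Periodic g 1)
    (hθ1 : ∀ u, θ (u + 1) = θ u + 2 * Real.pi) :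
    ∃ c, Real.pi * (∫ u in (0 : ℝ)..1, supportFn x θ c u ^ 2 * g u) ≤
        area x * (∫ u in (0 : ℝ)..1, g u) ∧
      (Real.pi * (∫ u in (0 : ℝ)..1, supportFn x θ c u ^ 2 * g u) <
        area x * (∫ u in (0 : ℝ)..1, g u) ∨ ∃ r, ∀ u, supportFn x θ c u = r) := by
  obtain ⟨a, b, c, hab, hba, hθ, hx, hAA⟩ := h.exists_bisecting_chord hκ hper hθ1
  refine ⟨c, ?_⟩
  have hA := h.area_eq hper c
  obtain ⟨l1, s1⟩ := h.gage_half hκ hab hθ hx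
  obtain ⟨l2, s2⟩ := h.gage_half hκ hba (by rw [hθ1, hθ]; ring) (by rw [hper, hx]; ring)
  have hpper := supportFn_periodic hper hθ1 c
  set p := supportFn x θ c with hp
  have hpc : Continuous p := h.support_cont c
  have hgc := h.speed_cont
  have shift : ∀ f : ℝ → ℝ, Continuous f → Function.Periodic f 1 →
      ∫ u in (0 : ℝ)..1, f u = (∫ u in a..b, f u) + ∫ u in b..(a + 1), f u := by
    intro f hf hfp
    rw [intervalIntegral.integral_add_adjacent_intervals (hf.intervalIntegrable _ _)
      (hf.intervalIntegrable _ _)]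
    have := hfp.intervalIntegral_add_eq 0 a
    rwa [zero_add] at this
  have A1 := shift (fun u => p u * g u) (by fun_prop) fun u => by simp only [hpper u, hgper u]
  have A2 := shift (fun u => p u ^ 2 * g u) (by fun_prop) fun u => by simp only [hpper u, hgper u]
  have A3 := shift g hgc hgper
  rw [A1, ← hAA] at hA
  have hA' : ∫ u in a..b, p u * g u = area x := by linarith
  rw [← hAA] at l2 s2
  rw [hA'] at l1 l2 s1 s2
  rw [A2, A3]
  refine ⟨by linarith, ?_⟩
  rcases s1 with s1 | s1
  · left; linarith
  · rcases s2 with s2 | s2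
    · left; linarith
    · right
      have pb : p b = p a := s1 b ⟨hab.le, le_rfl⟩
      refine ⟨p a, fun u => ?_⟩
      obtain ⟨v, hv, hv2⟩ := hpper.exists_mem_Ico one_pos u a
      rw [hv2]
      rcases le_total v b with hvb | hvb
      · exact s1 v ⟨hv.1, hvb⟩
      · rw [s2 v ⟨hvb, hv.2.le⟩, pb]

/-- Minkowski's formula `∫ k p ds = L`: the difference `g - κ p` is the derivative of the periodic
function `tangentialFn`. -/
theorem integral_curv_mul_support (h : HasAngle x g κ θ) (hper : Function.Periodic x 1)
    (hθ1 : ∀ u, θ (u + 1) = θ u + 2 * Real.pi) (c : ℂ) :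
    ∫ u in (0 : ℝ)..1, κ u * supportFn x θ c u = ∫ u in (0 : ℝ)..1, g u := by
  have hpc := h.support_cont c
  have hgc := h.speed_cont
  have hκc := h.curv_cont
  have i2 : ∫ u in (0 : ℝ)..1, (g u - κ u * supportFn x θ c u) = 0 := by
    rw [intervalIntegral.integral_eq_sub_of_hasDerivAt (fun u _ => h.tangential_deriv c u)
      (by apply Continuous.intervalIntegrable; fun_prop)]
    have h1 := hper 0
    have h2 := hθ1 0
    rw [zero_add] at h1 h2
    simp only [tangentialFn, h1, h2, Real.sin_add_two_pi, Real.cos_add_two_pi, sub_self]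
  rw [intervalIntegral.integral_sub] at i2
  · linarith
  all_goals apply Continuous.intervalIntegrable; fun_prop

/-- This is `∫ (k - μ p)² ds ≥ 0`, expanded by Minkowski's formula. Since `κ = k g`, the term `κ² /
g` is `k² ds`. -/
theorem curvature_quadratic_nonneg (h : HasAngle x g κ θ) (hper : Function.Periodic x 1)
    (hθ1 : ∀ u, θ (u + 1) = θ u + 2 * Real.pi) (c : ℂ) (μ : ℝ) :
    0 ≤ (∫ u in (0 : ℝ)..1, κ u ^ 2 / g u) - 2 * μ * (∫ u in (0 : ℝ)..1, g u) +
      μ ^ 2 * ∫ u in (0 : ℝ)..1, supportFn x θ c u ^ 2 * g u := by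
  have hpc := h.support_cont c
  have hgc := h.speed_cont
  have hκc := h.curv_cont
  have hg0 := h.speed_pos
  have hg0' : ∀ u, g u ≠ 0 := fun u => (hg0 u).ne'
  have e : ∀ u, (κ u - μ * supportFn x θ c u * g u) ^ 2 / g u = κ u ^ 2 / g u
      - 2 * μ * (κ u * supportFn x θ c u) + μ ^ 2 * (supportFn x θ c u ^ 2 * g u) := by
    intro u; have := hg0' u; field_simp; ring
  have hnn : 0 ≤ ∫ u in (0 : ℝ)..1, (κ u - μ * supportFn x θ c u * g u) ^ 2 / g u :=
    intervalIntegral.integral_nonneg zero_le_one fun u _ => by have := hg0 u; positivity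
  simp_rw [e] at hnn
  rw [intervalIntegral.integral_add, intervalIntegral.integral_sub,
    intervalIntegral.integral_const_mul, intervalIntegral.integral_const_mul,
    h.integral_curv_mul_support hper hθ1] at hnn
  · exact hnn
  all_goals apply Continuous.intervalIntegrable; fun_prop (disch := assumption)

/-- With `μ = π / A`, the bound `π ∫ p² ds ≤ A L` turns `2 μ L - μ² ∫ p² ds` into at least `π L /
A`. -/
theorem gage_inequality (h : HasAngle x g κ θ) (hκ : ∀ u, 0 ≤ κ u)
    (hper : Function.Periodic x 1) (hgper : Function.Periodic g 1)
    (hθ1 : ∀ u, θ (u + 1) = θ u + 2 * Real.pi) (hA : 0 < area x) :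
    Real.pi / area x * (∫ u in (0 : ℝ)..1, g u) ≤ ∫ u in (0 : ℝ)..1, κ u ^ 2 / g u := by
  obtain ⟨c, h1, -⟩ := h.exists_center_integral_sq_le hκ hper hgper hθ1
  have h2 := h.curvature_quadratic_nonneg hper hθ1 c (Real.pi / area x)
  set P := ∫ u in (0 : ℝ)..1, supportFn x θ c u ^ 2 * g u
  set ℓ := ∫ u in (0 : ℝ)..1, g u
  have h3 : (Real.pi / area x) ^ 2 * P ≤ Real.pi / area x * ℓ := by
    have : (Real.pi / area x) ^ 2 * P = Real.pi / area x ^ 2 * (Real.pi * P) := by ring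
    rw [this]
    calc Real.pi / area x ^ 2 * (Real.pi * P) ≤ Real.pi / area x ^ 2 * (area x * ℓ) := by
          have := Real.pi_pos; gcongr
      _ = _ := by field_simp
  linarith

/-- A constant support function `r` would force the tangential component to vanish, as `κ > 0`, and
hence `g = r κ`, which is excluded. So `π ∫ p² ds < A L` strictly, and both conclusions inherit the
strictness; the second uses Cauchy-Schwarz with `∫ p ds = 2 A`. -/
theorem gage_isoperimetric_strict (h : HasAngle x g κ θ) (hκ : ∀ u, 0 < κ u)
    (hper : Function.Periodic x 1) (hgper : Function.Periodic g 1)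
    (hθ1 : ∀ u, θ (u + 1) = θ u + 2 * Real.pi) (hA : 0 < area x)
    (hcirc : ¬ ∃ r : ℝ, ∀ u, r * κ u = g u) :
    Real.pi / area x * (∫ u in (0 : ℝ)..1, g u) < ∫ u in (0 : ℝ)..1, κ u ^ 2 / g u ∧
      4 * Real.pi * area x < (∫ u in (0 : ℝ)..1, g u) ^ 2 := by
  obtain ⟨c, -, h1⟩ := h.exists_center_integral_sq_le (fun u => (hκ u).le) hper hgper hθ1
  have hpi := Real.pi_pos
  have h1 : Real.pi * (∫ u in (0 : ℝ)..1, supportFn x θ c u ^ 2 * g u) <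
        area x * (∫ u in (0 : ℝ)..1, g u) := by
    refine h1.resolve_right ?_
    rintro ⟨r, hr⟩
    have hq : ∀ u, tangentialFn x θ c u = 0 := by
      intro u
      have h3 : HasDerivAt (supportFn x θ c) 0 u := by
        rw [funext hr]; exact hasDerivAt_const _ _
      have := (h.support_deriv c u).unique h3
      simpa [(hκ u).ne'] using this
    refine hcirc ⟨r, fun u => ?_⟩
    have h3 : HasDerivAt (tangentialFn x θ c) 0 u := by
      rw [funext hq]; exact hasDerivAt_const _ _
    have := (h.tangential_deriv c u).unique h3
    rw [hr] at this
    linarith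
  have h2 := h.curvature_quadratic_nonneg hper hθ1 c (Real.pi / area x)
  have hAeq := h.area_eq hper c
  have hℓ : 0 < ∫ u in (0 : ℝ)..1, g u := intervalIntegral.intervalIntegral_pos_of_pos
    (h.speed_cont.intervalIntegrable _ _) h.speed_pos one_pos
  have hpc := h.support_cont c
  have hgc := h.speed_cont
  have h4 : ∀ μ : ℝ, 0 ≤ (∫ u in (0 : ℝ)..1, supportFn x θ c u ^ 2 * g u)
      - 4 * μ * area x + μ ^ 2 * ∫ u in (0 : ℝ)..1, g u := by
    intro μ
    have e : ∀ u, (supportFn x θ c u - μ) ^ 2 * g u = supportFn x θ c u ^ 2 * g u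
        - 2 * μ * (supportFn x θ c u * g u) + μ ^ 2 * g u := by intro u; ring
    have hnn : 0 ≤ ∫ u in (0 : ℝ)..1, (supportFn x θ c u - μ) ^ 2 * g u :=
      intervalIntegral.integral_nonneg zero_le_one fun u _ => by
        have := h.speed_pos u; positivity
    simp_rw [e] at hnn
    rw [intervalIntegral.integral_add, intervalIntegral.integral_sub,
      intervalIntegral.integral_const_mul, intervalIntegral.integral_const_mul] at hnn
    · rw [hAeq]; linarith
    all_goals apply Continuous.intervalIntegrable; fun_prop
  set P := ∫ u in (0 : ℝ)..1, supportFn x θ c u ^ 2 * g u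
  set ℓ := ∫ u in (0 : ℝ)..1, g u
  constructor
  · have h3 : (Real.pi / area x) ^ 2 * P < Real.pi / area x * ℓ := by
      have : (Real.pi / area x) ^ 2 * P = Real.pi / area x ^ 2 * (Real.pi * P) := by ring
      rw [this]
      calc Real.pi / area x ^ 2 * (Real.pi * P) < Real.pi / area x ^ 2 * (area x * ℓ) := by
            gcongr
        _ = _ := by field_simp
    linarith
  -- `2 A / L` is the mean of `p`, the choice for which `∫ (p - μ)² ds ≥ 0` becomes Cauchy-Schwarz.
  · have h5 := h4 (2 * area x / ℓ)
    have h6 : P - 4 * (2 * area x / ℓ) * area x + (2 * area x / ℓ) ^ 2 * ℓ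
        = (P * ℓ - 4 * area x ^ 2) / ℓ := by field_simp; ring
    rw [h6] at h5
    have h7 : 0 ≤ P * ℓ - 4 * area x ^ 2 := by
      by_contra hneg
      push Not at hneg
      exact absurd h5 (not_le.2 (div_neg_of_neg_of_pos hneg hℓ))
    have h8 : Real.pi * P * ℓ < area x * ℓ * ℓ := by gcongr
    have h9 : area x * (4 * Real.pi * area x) < area x * ℓ ^ 2 := by nlinarith
    exact lt_of_mul_lt_mul_left h9 hA.le

end HasAngle

/-! ### The tangent angle and the total curvature -/

/-- The derivative of the tangent angle with respect to the parameter. -/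
noncomputable def turning (x : ℝ → ℂ) (u : ℝ) : ℝ := (deriv (deriv x) u / deriv x u).im

section regular

variable {x : ℝ → ℂ}

/-- A logarithm of `x'` is obtained by integrating `x'' / x'`. Its real part is the logarithm of the
speed and its imaginary part a smooth choice of tangent angle. -/
theorem exists_log_deriv (hx : ContDiff ℝ 2 x) (hreg : ∀ u, deriv x u ≠ 0) :
    ∃ Z : ℝ → ℂ, (∀ u, Complex.exp (Z u) = deriv x u) ∧
      ∀ u, HasDerivAt Z (deriv (deriv x) u / deriv x u) u := by
  have h1 : ContDiff ℝ 1 (deriv x) := ((contDiff_succ_iff_deriv (n := 1)).1 hx).2.2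
  have hd : ∀ u, HasDerivAt (deriv x) (deriv (deriv x) u) u := fun u =>
    (h1.differentiable (by norm_num) u).hasDerivAt
  have hψ : Continuous fun u => deriv (deriv x) u / deriv x u :=
    (h1.continuous_deriv le_rfl).div h1.continuous hreg
  set Z : ℝ → ℂ := fun u => Complex.log (deriv x 0) + ∫ v in (0 : ℝ)..u,
    deriv (deriv x) v / deriv x v with hZ
  have hZd : ∀ u, HasDerivAt Z (deriv (deriv x) u / deriv x u) u := fun u =>
    (intervalIntegral.integral_hasDerivAt_right (hψ.intervalIntegrable _ _)
      hψ.stronglyMeasurable.stronglyMeasurableAtFilter hψ.continuousAt).const_add _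
  refine ⟨Z, fun u => ?_, hZd⟩
  have hF : ∀ u, HasDerivAt (fun u => deriv x u * Complex.exp (-Z u)) 0 u := fun u => by
    refine ((hd u).mul ((hZd u).neg.cexp)).congr_deriv ?_
    have := hreg u
    field_simp; ring
  have hc := is_const_of_deriv_eq_zero (fun u => (hF u).differentiableAt)
    (fun u => (hF u).deriv) u 0
  have h0 : Complex.exp (Z 0) = deriv x 0 := by simp [hZ, Complex.exp_log (hreg 0)]
  rw [← h0, ← Complex.exp_add, add_neg_cancel, Complex.exp_zero, Complex.exp_neg] at hc
  have := Complex.exp_ne_zero (Z u)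
  field_simp at hc
  exact hc.symm

theorem exists_hasAngle_log (hx : ContDiff ℝ 2 x) (hreg : ∀ u, deriv x u ≠ 0) :
    ∃ Z : ℝ → ℂ, Continuous Z ∧ (∀ u, Complex.exp (Z u) = deriv x u) ∧
      HasAngle x (speed x) (turning x) fun u => (Z u).im := by
  obtain ⟨Z, hZ, hZd⟩ := exists_log_deriv hx hreg
  have h1 : ContDiff ℝ 1 (deriv x) := ((contDiff_succ_iff_deriv (n := 1)).1 hx).2.2
  refine ⟨Z, continuous_iff_continuousAt.2 fun u => (hZd u).continuousAt, hZ, ?_, ?_, ?_, ?_, ?_⟩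
  · intro u
    have : (speed x u * Complex.exp ((Z u).im * Complex.I) : ℂ) = deriv x u := by
      rw [speed, ← hZ, Complex.norm_exp, Complex.ofReal_exp, ← Complex.exp_add, Complex.re_add_im]
    rw [this]
    exact (hx.differentiable (by norm_num) u).hasDerivAt
  · exact fun u => Complex.imCLM.hasFDerivAt.comp_hasDerivAt u (hZd u)
  · exact h1.continuous.norm
  · exact Complex.continuous_im.comp ((h1.continuous_deriv le_rfl).div h1.continuous hreg)
  · exact fun u => norm_pos_iff.2 (hreg u)

theorem exists_hasAngle (hx : ContDiff ℝ 2 x) (hreg : ∀ u, deriv x u ≠ 0) :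
    ∃ θ : ℝ → ℝ, HasAngle x (speed x) (turning x) θ := by
  obtain ⟨Z, -, -, h⟩ := exists_hasAngle_log hx hreg
  exact ⟨_, h⟩

end regular

namespace HasAngle

variable {x : ℝ → ℂ} {κ θ : ℝ → ℝ}

theorem tangent_eq (h : HasAngle x (speed x) κ θ) (u : ℝ) :
    tangent x u = Complex.exp (θ u * Complex.I) := by
  have := (h.speed_pos u).ne'
  rw [tangent, arcDeriv, (h.curve u).deriv, Complex.real_smul, Complex.ofReal_inv,
    inv_mul_cancel_left₀ (Complex.ofReal_ne_zero.2 this)]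

theorem tangent_deriv (h : HasAngle x (speed x) κ θ) (u : ℝ) :
    HasDerivAt (tangent x) (κ u • normal x u) u := by
  rw [funext h.tangent_eq, normal, h.tangent_eq]
  refine ((h.angle u).ofReal_comp.mul_const Complex.I).cexp.congr_deriv ?_
  rw [Complex.real_smul]; ring

theorem curvature_eq (h : HasAngle x (speed x) κ θ) (u : ℝ) : curvature x u = κ u / speed x u := by
  have e : arcDeriv x (arcDeriv x x) u = ((speed x u)⁻¹ * κ u) • normal x u := by
    change arcDeriv x (tangent x) u = _
    rw [arcDeriv, (h.tangent_deriv u).deriv, smul_smul]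
  have e2 : arcDeriv x x u = Complex.exp (θ u * Complex.I) := h.tangent_eq u
  rw [curvature, e, e2, normal, h.tangent_eq]
  have := Real.sin_sq_add_cos_sq (θ u)
  simp only [det, Complex.exp_ofReal_mul_I_re, Complex.exp_ofReal_mul_I_im, Complex.smul_re,
    Complex.smul_im, Complex.mul_re, Complex.mul_im, Complex.I_re, Complex.I_im, smul_eq_mul]
  rw [div_eq_inv_mul]
  linear_combination (speed x u)⁻¹ * κ u * this

/-- The principal argument jumps where the lifted angle does not, but they differ by multiples of
`2π`, which a periodic function does not see. -/
theorem comp_tangentAngle (h : HasAngle x (speed x) κ θ) {f : ℝ → ℝ}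
    (hf : Function.Periodic f (2 * Real.pi)) (u : ℝ) : f (tangentAngle x u) = f (θ u) := by
  rw [tangentAngle, h.tangent_eq, Complex.arg_exp_mul_I, toIocMod]
  exact hf.sub_zsmul_eq _

end HasAngle

/-! ### Continuous logarithms and the secants of a closed curve -/

theorem lift_exp_sub_eq {X : Type*} [TopologicalSpace X] [PreconnectedSpace X] {Z W : X → ℂ}
    (hZ : Continuous Z) (hW : Continuous W) (h : ∀ t, Complex.exp (Z t) = Complex.exp (W t))
    (a b : X) : Z b - Z a = W b - W a := by
  have := Complex.isCoveringMap_exp.eq_of_comp_eq hZ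
    (g₂ := fun t => W t + (Z a - W a)) (by fun_prop) (by
      funext t
      apply Subtype.ext
      simp only [Function.comp_apply]
      rw [Complex.exp_add, Complex.exp_sub, h, h a, div_self (Complex.exp_ne_zero _), mul_one]) a
    (by ring)
  have hb : Z b = W b + (Z a - W a) := congrFun this b
  rw [hb]; ring

theorem exists_continuous_log {f : ℝ × ℝ → ℂ} (hf : Continuous f) (h0 : ∀ z, f z ≠ 0) :
    ∃ W : ℝ × ℝ → ℂ, Continuous W ∧ ∀ z, Complex.exp (W z) = f z := by
  have : SimplyConnectedSpace (ℝ × ℝ) := SimplyConnectedSpace.ofContractible _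
  obtain ⟨W, ⟨-, hW⟩, -⟩ := Complex.isCoveringMapOn_exp.existsUnique_continuousMap_lifts
    (⟨f, hf⟩ : C(ℝ × ℝ, ℂ)) (a₀ := 0) (Complex.exp_log (h0 0)) (fun z => h0 z)
  exact ⟨W, W.continuous, fun z => congrFun hW z⟩

/-- The averages of the derivative over a chord. -/
noncomputable def chordMean (x : ℝ → ℂ) (s h : ℝ) : ℂ := ∫ r in (0 : ℝ)..1, deriv x (s + r * h)

theorem mul_chordMean {x : ℝ → ℂ} (hx : ContDiff ℝ 1 x) (s h : ℝ) :
    h * chordMean x s h = x (s + h) - x s := by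
  have hd : ∀ r, HasDerivAt (fun r => x (s + r * h)) (h * deriv x (s + r * h)) r := by
    intro r
    have h1 := (hx.differentiable (by norm_num) (s + r * h)).hasDerivAt
    have h2 : HasDerivAt (fun r => s + r * h) h r := by
      simpa using ((hasDerivAt_id r).mul_const h).const_add s
    exact (h1.scomp r h2).congr_deriv (by rw [Complex.real_smul])
  have hc : Continuous fun r => deriv x (s + r * h) :=
    (hx.continuous_deriv le_rfl).comp (by fun_prop)
  rw [chordMean, ← intervalIntegral.integral_const_mul,
    intervalIntegral.integral_eq_sub_of_hasDerivAt (fun r _ => hd r)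
      (by apply Continuous.intervalIntegrable; fun_prop)]
  simp

theorem continuous_chordMean {x : ℝ → ℂ} (hx : ContDiff ℝ 1 x) :
    Continuous fun z : ℝ × ℝ => chordMean x z.1 z.2 := by
  refine intervalIntegral.continuous_parametric_intervalIntegral_of_continuous' ?_ 0 1
  have := hx.continuous_deriv le_rfl
  simp only [Function.uncurry_def]
  fun_prop

/-- A continuous extension of `(x (s + h) - x s) / (h (1 - h))`, for a `1`-periodic `x`. -/
noncomputable def secant (x : ℝ → ℂ) (s h : ℝ) : ℂ :=
  chordMean x s h - chordMean x (s + h - 1) (1 - h)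

section secant

variable {x : ℝ → ℂ}

/-- Partial fractions, `1/(h(1-h)) = 1/h + 1/(1-h)`: by periodicity the second chord mean in
`secant` belongs to the complementary arc, traversed back to the starting point. -/
theorem mul_secant (hx : ContDiff ℝ 1 x) (hper : Function.Periodic x 1) (s h : ℝ) :
    ((h * (1 - h) : ℝ) : ℂ) * secant x s h = x (s + h) - x s := by
  have h1 := mul_chordMean hx s h
  have h2 := mul_chordMean hx (s + h - 1) (1 - h)
  have h3 := hper (s + h - 1)
  rw [sub_add_cancel] at h3
  rw [show s + h - 1 + (1 - h) = s by ring, ← h3] at h2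
  push_cast at h2 ⊢
  rw [secant]
  linear_combination (1 - (h : ℂ)) * h1 - h * h2

theorem chordMean_zero (s : ℝ) : chordMean x s 0 = deriv x s := by simp [chordMean]

theorem chordMean_one (hx : ContDiff ℝ 1 x) (hper : Function.Periodic x 1) (s : ℝ) :
    chordMean x s 1 = 0 := by
  have := mul_chordMean hx s 1
  rw [hper, sub_self] at this
  simpa using this

theorem secant_zero (hx : ContDiff ℝ 1 x) (hper : Function.Periodic x 1) (s : ℝ) :
    secant x s 0 = deriv x s := by
  simp [secant, chordMean_zero, chordMean_one hx hper]

theorem secant_one (hx : ContDiff ℝ 1 x) (hper : Function.Periodic x 1) (s : ℝ) :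
    secant x s 1 = -deriv x s := by
  simp [secant, chordMean_zero, chordMean_one hx hper]

theorem chordMean_periodic (hper : Function.Periodic x 1) (h : ℝ) :
    Function.Periodic (fun s => chordMean x s h) 1 := by
  have hd : Function.Periodic (deriv x) 1 := by
    intro u
    have : (fun v => x (v + 1)) = x := funext hper
    rw [← deriv_comp_add_const, this]
  intro s
  simp only [chordMean, add_right_comm s 1, hd _]

theorem secant_symm (hper : Function.Periodic x 1) (s h : ℝ) :
    secant x (s + h) (1 - h) = -secant x s h := by
  have h1 : chordMean x (s + h - 1) (1 - h) = chordMean x (s + h) (1 - h) := by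
    have := chordMean_periodic hper (1 - h) (s + h - 1)
    simp only [sub_add_cancel] at this
    exact this.symm
  simp only [secant, h1, sub_sub_cancel]
  rw [show s + h + (1 - h) - 1 = s by ring]
  ring

theorem continuous_secant (hx : ContDiff ℝ 1 x) :
    Continuous fun z : ℝ × ℝ => secant x z.1 z.2 := by
  have h := continuous_chordMean hx
  exact h.sub (h.comp (by fun_prop : Continuous fun z : ℝ × ℝ => (z.1 + z.2 - 1, 1 - z.2)))

theorem ne_of_periodic_injOn (hper : Function.Periodic x 1) (hinj : InjOn x (Ico 0 1)) {s h : ℝ}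
    (h0 : 0 < h) (h1 : h < 1) : x (s + h) ≠ x s := by
  intro heq
  have hfr : ∀ u, x u = x (Int.fract u) := fun u => by
    have := hper.sub_zsmul_eq (x := u) ⌊u⌋
    rw [zsmul_eq_mul, mul_one] at this
    exact this.symm
  rw [hfr, hfr s] at heq
  have h2 := hinj ⟨Int.fract_nonneg _, Int.fract_lt_one _⟩
    ⟨Int.fract_nonneg _, Int.fract_lt_one _⟩ heq
  obtain ⟨n, hn⟩ := Int.fract_eq_fract.1 h2
  rw [add_sub_cancel_left] at hn
  rw [hn] at h0 h1
  have a1 : (0 : ℤ) < n := by exact_mod_cast h0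
  have a2 : n < (1 : ℤ) := by exact_mod_cast h1
  omega

theorem secant_ne_zero (hx : ContDiff ℝ 1 x) (hper : Function.Periodic x 1)
    (hreg : ∀ u, deriv x u ≠ 0) (hinj : InjOn x (Ico 0 1)) (s : ℝ) {h : ℝ} (hh : h ∈ Icc 0 1) :
    secant x s h ≠ 0 := by
  rcases eq_or_lt_of_le hh.1 with h0 | h0
  · rw [← h0, secant_zero hx hper]; exact hreg s
  rcases eq_or_lt_of_le hh.2 with h1 | h1
  · rw [h1, secant_one hx hper]; exact neg_ne_zero.2 (hreg s)
  intro h2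
  have := mul_secant hx hper s h
  rw [h2, mul_zero] at this
  exact ne_of_periodic_injOn hper hinj h0 h1 (sub_eq_zero.1 this.symm)

theorem im_secant_nonneg (hx : ContDiff ℝ 1 x) (hper : Function.Periodic x 1) {s : ℝ}
    (hs : ∀ u, (x s).im ≤ (x u).im) {h : ℝ} (hh : h ∈ Icc 0 1) : 0 ≤ (secant x s h).im := by
  have hd : (deriv x s).im = 0 := by
    have h1 : HasDerivAt (fun u => (x u).im) (deriv x s).im s :=
      Complex.imCLM.hasFDerivAt.comp_hasDerivAt s (hx.differentiable (by norm_num) s).hasDerivAt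
    exact IsLocalMin.hasDerivAt_eq_zero (Eventually.of_forall hs) h1
  rcases eq_or_lt_of_le hh.1 with h0 | h0
  · rw [← h0, secant_zero hx hper, hd]
  rcases eq_or_lt_of_le hh.2 with h1 | h1
  · rw [h1, secant_one hx hper, Complex.neg_im, hd, neg_zero]
  have := congrArg Complex.im (mul_secant hx hper s h)
  rw [Complex.im_ofReal_mul, Complex.sub_im] at this
  have h2 := hs (s + h)
  have h3 : 0 < h * (1 - h) := mul_pos h0 (by linarith)
  by_contra hneg
  push Not at hneg
  nlinarith

/-- Hopf's Umlaufsatz: the total curvature of a simple closed curve is `2π` or `-2π`. -/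
theorem integral_turning_eq (hx : ContDiff ℝ 2 x) (hper : Function.Periodic x 1)
    (hreg : ∀ u, deriv x u ≠ 0) (hinj : InjOn x (Ico 0 1)) :
    ∫ u in (0 : ℝ)..1, turning x u = 2 * Real.pi ∨
      ∫ u in (0 : ℝ)..1, turning x u = -(2 * Real.pi) := by
  have hx1 : ContDiff ℝ 1 x := hx.of_le (by norm_num)
  obtain ⟨Z, hZc, hZ, hang⟩ := exists_hasAngle_log hx hreg
  obtain ⟨s, hs⟩ : ∃ s, ∀ u, (x s).im ≤ (x u).im := by
    obtain ⟨s, -, hs⟩ := isCompact_Icc.exists_isMinOn (nonempty_Icc.2 (zero_le_one' ℝ))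
      (f := fun u => (x u).im) (Complex.continuous_im.comp hx.continuous).continuousOn
    refine ⟨s, fun u => ?_⟩
    obtain ⟨v, hv, hv2⟩ := hper.exists_mem_Ico₀ one_pos u
    rw [hv2]
    exact hs ⟨hv.1, hv.2.le⟩
  -- Clamping `h` to `[0, 1]` extends the nonvanishing secant map to the whole plane, which is
  -- simply connected, so that a global continuous logarithm `W` exists.
  set cl : ℝ → ℝ := fun h => max 0 (min 1 h) with hcl
  have hclc : Continuous cl := by fun_prop
  have hclm : ∀ h, cl h ∈ Icc (0 : ℝ) 1 := fun h =>
    ⟨le_max_left _ _, max_le zero_le_one (min_le_left _ _)⟩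
  have hcl1 : ∀ h ∈ Icc (0 : ℝ) 1, cl h = h := fun h hh => by
    simp only [hcl, min_eq_right hh.2, max_eq_right hh.1]
  have h01 : (0 : ℝ) ∈ Icc (0 : ℝ) 1 := by simp
  have h11 : (1 : ℝ) ∈ Icc (0 : ℝ) 1 := by simp
  have hSc : Continuous fun z : ℝ × ℝ => secant x z.1 (cl z.2) :=
    (continuous_secant hx1).comp (by fun_prop : Continuous fun z : ℝ × ℝ => (z.1, cl z.2))
  obtain ⟨W, hWc, hW⟩ := exists_continuous_log hSc
    fun z => secant_ne_zero hx1 hper hreg hinj z.1 (hclm z.2)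
  -- On the edge `h = 0` the secant is the tangent, so the total turning is the increment of `W`
  -- from `(s, 0)` to `(s + 1, 0)`. The next identity, from the antisymmetry of the secant, equates
  -- the increments over the two legs through `(s, 1)`, so the turning is twice the increment along
  -- the leg at fixed `s`.
  have e1 := lift_exp_sub_eq (Z := Z) (W := fun u => W (u, 0)) hZc (by fun_prop)
    (fun u => by rw [hZ, hW]; simp only [hcl1 0 h01, secant_zero hx1 hper]) s (s + 1)
  have e2 := lift_exp_sub_eq (Z := fun h : ℝ => W (s + cl h, 1 - cl h))
    (W := fun h : ℝ => W (s, h) + Real.pi * Complex.I) (by fun_prop) (by fun_prop)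
    (fun h => by
      have hm := hclm h
      rw [hW, Complex.exp_add, hW, Complex.exp_pi_mul_I]
      simp only [hcl1 (1 - cl h) ⟨by linarith [hm.2], by linarith [hm.1]⟩, secant_symm hper]
      ring) 0 1
  -- As `x s` is a lowest point, all secants from it lie in the closed upper half plane. Rotated by
  -- `-i` they avoid the cut of the principal logarithm, which therefore computes the increment of
  -- `W` along this leg.
  have hmem : ∀ h, -Complex.I * secant x s (cl h) ∈ Complex.slitPlane := fun h => by
    have h1 := im_secant_nonneg hx1 hper hs (hclm h)
    have h2 := secant_ne_zero hx1 hper hreg hinj s (hclm h)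
    rw [Complex.mem_slitPlane_iff]
    by_contra hcon
    push Not at hcon
    simp only [neg_mul, Complex.neg_re, Complex.mul_re, Complex.I_re, Complex.I_im, zero_mul,
      one_mul, zero_sub, neg_neg, Complex.neg_im, Complex.mul_im, zero_add,
      neg_eq_zero] at hcon
    exact h2 (Complex.ext hcon.2 (le_antisymm hcon.1 h1))
  have hSc' : Continuous fun h : ℝ => secant x s (cl h) :=
    hSc.comp (by fun_prop : Continuous fun h : ℝ => (s, h))
  have e3 := lift_exp_sub_eq (Z := fun h : ℝ => W (s, h))
    (W := fun h : ℝ => Complex.log (-Complex.I * secant x s (cl h)) + Real.pi / 2 * Complex.I)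
    (by fun_prop)
    (by
      refine Continuous.add (Continuous.clog (by fun_prop) hmem) (by fun_prop))
    (fun h => by
      rw [hW, Complex.exp_add, Complex.exp_log (Complex.slitPlane_ne_zero (hmem h)),
        Complex.exp_pi_div_two_mul_I]
      linear_combination (secant x s (cl h)) * Complex.I_sq) 0 1
  simp only [hcl1 0 h01, hcl1 1 h11, add_zero, sub_zero, sub_self, add_sub_add_right_eq_sub,
    secant_zero hx1 hper, secant_one hx1 hper] at e2 e3
  have him : (deriv x s).im = 0 := by
    have h1 := im_secant_nonneg hx1 hper hs h01
    have h2 := im_secant_nonneg hx1 hper hs h11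
    rw [secant_zero hx1 hper] at h1
    rw [secant_one hx1 hper, Complex.neg_im] at h2
    linarith
  obtain ⟨r, hr⟩ : ∃ r : ℝ, deriv x s = r := ⟨(deriv x s).re, Complex.ext rfl (by simp [him])⟩
  have hr0 : r ≠ 0 := fun h => hreg s (by rw [hr, h]; simp)
  have key : (Z (s + 1) - Z s).im = 2 * ((Complex.log (-Complex.I * -deriv x s)).im
      - (Complex.log (-Complex.I * deriv x s)).im) := by
    have : Z (s + 1) - Z s = 2 * (Complex.log (-Complex.I * -deriv x s)
      - Complex.log (-Complex.I * deriv x s)) := by linear_combination e1 + e2 + 2 * e3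
    rw [this]
    simp
  have hper' : Function.Periodic (turning x) 1 := by
    have hd : ∀ {f : ℝ → ℂ}, Function.Periodic f 1 → Function.Periodic (deriv f) 1 := by
      intro f hf u
      have : (fun v => f (v + 1)) = f := funext hf
      rw [← deriv_comp_add_const, this]
    intro u
    simp only [turning, hd hper u, hd (hd hper) u]
  have hint : ∫ u in (0 : ℝ)..1, turning x u = (Z (s + 1) - Z s).im := by
    have := hper'.intervalIntegral_add_eq 0 s
    rw [zero_add] at this
    rw [this, intervalIntegral.integral_eq_sub_of_hasDerivAt (fun u _ => hang.angle u)
      (hang.curv_cont.intervalIntegrable _ _), Complex.sub_im]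
  have e4 : -Complex.I * -deriv x s = r * Complex.I := by rw [hr]; ring
  have e5 : -Complex.I * deriv x s = (-r : ℝ) * Complex.I := by rw [hr]; push_cast; ring
  have pos : ∀ t : ℝ, 0 < t → Complex.arg (t * Complex.I) = Real.pi / 2 := fun t ht => by
    rw [Complex.arg_real_mul _ ht, Complex.arg_I]
  have neg : ∀ t : ℝ, t < 0 → Complex.arg (t * Complex.I) = -(Real.pi / 2) := fun t ht => by
    have : (t * Complex.I : ℂ) = (-t : ℝ) * (-Complex.I) := by push_cast; ring
    rw [this, Complex.arg_real_mul _ (by linarith), Complex.arg_neg_I]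
  rw [hint, key, Complex.log_im, Complex.log_im, e4, e5]
  rcases lt_or_gt_of_ne hr0 with h | h
  · right; rw [neg _ h, pos _ (by linarith)]; ring
  · left; rw [pos _ h, neg _ (by linarith)]; ring

end secant

/-! ### Partial derivatives of functions of time and parameter -/

section partials

theorem continuous_slice {E : Type*} [TopologicalSpace E] {I : Set ℝ} {G : ℝ × ℝ → E} (hG : ContinuousOn G (I ×ˢ univ)) {t : ℝ}
    (ht : t ∈ I) : Continuous fun u => G (t, u) := by
  rw [← continuousOn_univ]
  exact hG.comp (by fun_prop) fun u _ => ⟨ht, mem_univ u⟩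

variable {E : Type*} [NormedAddCommGroup E] [NormedSpace ℝ E]

/-- The derivative in the second variable. -/
noncomputable def partialU (G : ℝ × ℝ → E) (q : ℝ × ℝ) : E := deriv (fun v => G (q.1, v)) q.2

/-- The derivative in the first variable. -/
noncomputable def partialT (G : ℝ × ℝ → E) (q : ℝ × ℝ) : E := deriv (fun τ => G (τ, q.2)) q.1

theorem hasDerivAt_snd_of_contDiffOn {I : Set ℝ} {G : ℝ × ℝ → E}
    (hG : ContDiffOn ℝ ∞ G (I ×ˢ univ)) {t : ℝ} (ht : t ∈ I) (u : ℝ) :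
    HasDerivAt (fun v => G (t, v)) (fderivWithin ℝ G (I ×ˢ univ) (t, u) (0, 1)) u := by
  have h1 := (hG.differentiableOn (by simp) (t, u) ⟨ht, mem_univ _⟩).hasFDerivWithinAt
  have h2 : HasDerivWithinAt (fun v : ℝ => (t, v)) (0, 1) univ u :=
    ((hasDerivAt_const u t).prodMk (hasDerivAt_id u)).hasDerivWithinAt
  have h3 := h1.comp_hasDerivWithinAt u h2 (fun v _ => ⟨ht, mem_univ _⟩)
  exact hasDerivWithinAt_univ.1 h3

theorem partialU_eq_fderivWithin {I : Set ℝ} {G : ℝ × ℝ → E}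
    (hG : ContDiffOn ℝ ∞ G (I ×ˢ univ)) {q : ℝ × ℝ} (hq : q.1 ∈ I) :
    partialU G q = fderivWithin ℝ G (I ×ˢ univ) q (0, 1) :=
  (hasDerivAt_snd_of_contDiffOn hG hq q.2).deriv

theorem hasDerivAt_partialU {I : Set ℝ} {G : ℝ × ℝ → E}
    (hG : ContDiffOn ℝ ∞ G (I ×ˢ univ)) {t : ℝ} (ht : t ∈ I) (u : ℝ) :
    HasDerivAt (fun v => G (t, v)) (partialU G (t, u)) u :=
  (hasDerivAt_snd_of_contDiffOn hG ht u).differentiableAt.hasDerivAt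

theorem contDiffOn_partialU {I : Set ℝ} (hI : UniqueDiffOn ℝ I) {G : ℝ × ℝ → E}
    (hG : ContDiffOn ℝ ∞ G (I ×ˢ univ)) : ContDiffOn ℝ ∞ (partialU G) (I ×ˢ univ) := by
  have h := (hG.fderivWithin (m := ∞) (hI.prod uniqueDiffOn_univ) (by simp)).clm_apply
    (contDiffOn_const (c := ((0, 1) : ℝ × ℝ)))
  exact h.congr fun q hq => partialU_eq_fderivWithin hG hq.1

theorem hasDerivAt_fst_of_contDiffOn {J : Set ℝ} (hJ : IsOpen J) {G : ℝ × ℝ → E}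
    (hG : ContDiffOn ℝ ∞ G (J ×ˢ univ)) {t : ℝ} (ht : t ∈ J) (u : ℝ) :
    HasDerivAt (fun τ => G (τ, u)) (fderiv ℝ G (t, u) (1, 0)) t := by
  have h1 := ((hG.contDiffAt ((hJ.prod isOpen_univ).mem_nhds
    (show (t, u) ∈ J ×ˢ univ from ⟨ht, mem_univ u⟩))).differentiableAt
    (by simp)).hasFDerivAt
  have h2 : HasDerivAt (fun τ : ℝ => (τ, u)) (1, 0) t :=
    (hasDerivAt_id t).prodMk (hasDerivAt_const t u)
  exact h1.comp_hasDerivAt t h2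

theorem partialT_eq_fderiv {J : Set ℝ} (hJ : IsOpen J) {G : ℝ × ℝ → E}
    (hG : ContDiffOn ℝ ∞ G (J ×ˢ univ)) {q : ℝ × ℝ} (hq : q.1 ∈ J) :
    partialT G q = fderiv ℝ G q (1, 0) :=
  (hasDerivAt_fst_of_contDiffOn hJ hG hq q.2).deriv

theorem hasDerivAt_partialT {J : Set ℝ} (hJ : IsOpen J) {G : ℝ × ℝ → E}
    (hG : ContDiffOn ℝ ∞ G (J ×ˢ univ)) {t : ℝ} (ht : t ∈ J) (u : ℝ) :
    HasDerivAt (fun τ => G (τ, u)) (partialT G (t, u)) t :=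
  (hasDerivAt_fst_of_contDiffOn hJ hG ht u).differentiableAt.hasDerivAt

theorem contDiffOn_partialT {J : Set ℝ} (hJ : IsOpen J) {G : ℝ × ℝ → E}
    (hG : ContDiffOn ℝ ∞ G (J ×ˢ univ)) : ContDiffOn ℝ ∞ (partialT G) (J ×ˢ univ) := by
  have h := (hG.fderiv_of_isOpen (m := ∞) (hJ.prod isOpen_univ) (by simp)).clm_apply
    (contDiffOn_const (c := ((1, 0) : ℝ × ℝ)))
  exact h.congr fun q hq => partialT_eq_fderiv hJ hG hq.1

theorem partialT_partialU {J : Set ℝ} (hJ : IsOpen J) {G : ℝ × ℝ → E}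
    (hG : ContDiffOn ℝ ∞ G (J ×ˢ univ)) {q : ℝ × ℝ} (hq : q.1 ∈ J) :
    partialT (partialU G) q = partialU (partialT G) q := by
  have hopen : IsOpen (J ×ˢ (univ : Set ℝ)) := hJ.prod isOpen_univ
  have hmem : J ×ˢ (univ : Set ℝ) ∈ 𝓝 q := hopen.mem_nhds ⟨hq, mem_univ _⟩
  have hGq : ContDiffAt ℝ ∞ G q := hG.contDiffAt hmem
  have hd : DifferentiableAt ℝ (fderiv ℝ G) q :=
    (hGq.fderiv_right (m := 1) (by norm_cast)).differentiableAt (by norm_num)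
  have hU : partialU G =ᶠ[𝓝 q] fun q => fderiv ℝ G q (0, 1) := by
    filter_upwards [hmem] with p hp
    rw [partialU_eq_fderivWithin hG hp.1, fderivWithin_of_isOpen hopen hp]
  have hT : partialT G =ᶠ[𝓝 q] fun q => fderiv ℝ G q (1, 0) := by
    filter_upwards [hmem] with p hp using partialT_eq_fderiv hJ hG hp.1
  rw [partialT_eq_fderiv hJ (contDiffOn_partialU hJ.uniqueDiffOn hG) hq,
    partialU_eq_fderivWithin (contDiffOn_partialT hJ hG) hq,
    fderivWithin_of_isOpen hopen ⟨hq, mem_univ _⟩, hU.fderiv_eq, hT.fderiv_eq,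
    fderiv_clm_apply hd (differentiableAt_const _), fderiv_clm_apply hd (differentiableAt_const _)]
  simp only [fderiv_fun_const, Pi.zero_apply, ContinuousLinearMap.comp_zero, zero_add,
    ContinuousLinearMap.flip_apply]
  exact (hGq.isSymmSndFDerivAt (by simpa using ENat.LEInfty.out)) (1, 0) (0, 1)

theorem continuousOn_integral {I : Set ℝ} {G : ℝ × ℝ → E} (hG : ContinuousOn G (I ×ˢ univ)) :
    ContinuousOn (fun t => ∫ u in (0 : ℝ)..1, G (t, u)) I := by
  rw [continuousOn_iff_continuous_domRestrict]
  refine intervalIntegral.continuous_parametric_intervalIntegral_of_continuous'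
    (f := fun (t : I) u => G (t, u)) ?_ 0 1
  exact hG.comp_continuous (by fun_prop) fun z => ⟨z.1.2, mem_univ _⟩

theorem hasDerivAt_integral [CompleteSpace E] {J : Set ℝ} (hJ : IsOpen J) {G : ℝ × ℝ → E}
    (hG : ContDiffOn ℝ ∞ G (J ×ˢ univ)) {t : ℝ} (ht : t ∈ J) :
    HasDerivAt (fun t => ∫ u in (0 : ℝ)..1, G (t, u)) (∫ u in (0 : ℝ)..1, partialT G (t, u)) t := by
  obtain ⟨ε, hε, hball⟩ := Metric.nhds_basis_closedBall.mem_iff.1 (hJ.mem_nhds ht)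
  have hGc := hG.continuousOn
  have hTc := (contDiffOn_partialT hJ hG).continuousOn
  obtain ⟨C, hC⟩ := ((isCompact_closedBall t ε).prod
    (isCompact_Icc (a := (0 : ℝ)) (b := 1))).exists_bound_of_continuousOn
      (hTc.mono (prod_mono hball (subset_univ _)))
  refine (intervalIntegral.hasDerivAt_integral_of_dominated_loc_of_deriv_le
    (F := fun t u => G (t, u)) (F' := fun t u => partialT G (t, u)) (bound := fun _ => C)
    (Metric.closedBall_mem_nhds t hε) ?_ ?_ ?_ ?_ ?_ ?_).2
  · filter_upwards [hJ.mem_nhds ht] with τ hτ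
    exact (continuous_slice hGc hτ).aestronglyMeasurable
  · exact (continuous_slice hGc ht).intervalIntegrable _ _
  · exact (continuous_slice hTc ht).aestronglyMeasurable
  · refine Eventually.of_forall fun u hu τ hτ => hC (τ, u) ⟨hτ, ?_⟩
    rw [uIoc_of_le zero_le_one] at hu
    exact ⟨hu.1.le, hu.2⟩
  · simp
  · exact Eventually.of_forall fun u _ τ hτ => hasDerivAt_partialT hJ hG (hball hτ) u

end partials

/-! ### The time interval -/

/-- The open time interval `(0, T)`. -/
def openTimeInterval (T : EReal) : Set ℝ := {t : ℝ | 0 < t ∧ (t : EReal) < T}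

theorem isOpen_openTimeInterval (T : EReal) : IsOpen (openTimeInterval T) :=
  (isOpen_lt continuous_const continuous_id).inter
    (isOpen_lt continuous_coe_real_ereal continuous_const)

theorem openTimeInterval_subset (T : EReal) : openTimeInterval T ⊆ timeInterval T :=
  fun _ ht => ⟨ht.1.le, ht.2⟩

theorem ordConnected_timeInterval (T : EReal) : (timeInterval T).OrdConnected :=
  ⟨fun _ ha _ hb _ hc => ⟨ha.1.trans hc.1, lt_of_le_of_lt (EReal.coe_le_coe_iff.2 hc.2) hb.2⟩⟩

theorem zero_mem_timeInterval {T : EReal} (hT : 0 < T) : (0 : ℝ) ∈ timeInterval T :=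
  ⟨le_rfl, by simpa using hT⟩

theorem exists_mem_openTimeInterval {T : EReal} (hT : 0 < T) : ∃ t, t ∈ openTimeInterval T := by
  obtain ⟨t, h1, h2⟩ := EReal.lt_iff_exists_real_btwn.1 hT
  exact ⟨t, by exact_mod_cast h1, h2⟩

theorem interior_timeInterval (T : EReal) : interior (timeInterval T) = openTimeInterval T := by
  refine Subset.antisymm (fun t ht => ?_)
    (interior_maximal (openTimeInterval_subset T) (isOpen_openTimeInterval T))
  refine ⟨?_, (interior_subset ht).2⟩
  have : t ∈ interior (Ici (0 : ℝ)) := interior_mono (fun s hs => hs.1) ht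
  simpa using this

theorem uniqueDiffOn_timeInterval {T : EReal} (hT : 0 < T) : UniqueDiffOn ℝ (timeInterval T) := by
  refine uniqueDiffOn_convex (ordConnected_timeInterval T).convex ?_
  rw [interior_timeInterval]
  exact exists_mem_openTimeInterval hT

/-- If the derivative on the open interval has a limit at the endpoint and the function is
continuous there, that limit is the one-sided derivative. This gives the derivatives at `t = 0`
without differentiating under the integral there. -/
theorem hasDerivWithinAt_zero_of_continuousOn {T : EReal} (hT : 0 < T) {f f' : ℝ → ℝ}
    (hf : ContinuousOn f (timeInterval T)) (hf' : ContinuousOn f' (timeInterval T))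
    (hd : ∀ t ∈ openTimeInterval T, HasDerivAt f (f' t) t) :
    HasDerivWithinAt f (f' 0) (timeInterval T) 0 := by
  have h0 := zero_mem_timeInterval hT
  obtain ⟨s, hs⟩ := exists_mem_openTimeInterval hT
  have hsub : Ioo 0 s ⊆ openTimeInterval T := fun t ht =>
    ⟨ht.1, lt_trans (EReal.coe_lt_coe_iff.2 ht.2) hs.2⟩
  have hmem : openTimeInterval T ∈ 𝓝[>] (0 : ℝ) :=
    mem_of_superset (Ioo_mem_nhdsGT hs.1) hsub
  refine (hasDerivWithinAt_Ici_of_tendsto_deriv (s := openTimeInterval T)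
    (fun t ht => (hd t ht).differentiableAt.differentiableWithinAt)
    ((hf 0 h0).mono (openTimeInterval_subset T)) hmem ?_).mono fun t ht => ht.1
  have h1 : Tendsto f' (𝓝[>] 0) (𝓝 (f' 0)) := by
    refine (hf' 0 h0).mono_left ?_
    rw [nhdsWithin, nhdsWithin]
    refine le_inf inf_le_left ?_
    have : timeInterval T ∈ 𝓝[>] (0 : ℝ) := mem_of_superset hmem (openTimeInterval_subset T)
    exact le_principal_iff.2 this
  refine h1.congr' ?_
  filter_upwards [hmem] with t ht using (hd t ht).deriv.symm

/-! ### First variation of length and area -/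

theorem periodic_deriv {E : Type*} [NormedAddCommGroup E] [NormedSpace ℝ E] {f : ℝ → E} {c : ℝ}
    (hf : Function.Periodic f c) : Function.Periodic (deriv f) c := by
  intro u
  have : (fun v => f (v + c)) = f := funext hf
  rw [← deriv_comp_add_const, this]

theorem hasDerivAt_det {f g : ℝ → ℂ} {f' g' : ℂ} {u : ℝ} (hf : HasDerivAt f f' u)
    (hg : HasDerivAt g g' u) :
    HasDerivAt (fun u => det (f u) (g u)) (det f' (g u) + det (f u) g') u := by
  have h1 := Complex.reCLM.hasFDerivAt.comp_hasDerivAt u hf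
  have h2 := Complex.imCLM.hasFDerivAt.comp_hasDerivAt u hf
  have h3 := Complex.reCLM.hasFDerivAt.comp_hasDerivAt u hg
  have h4 := Complex.imCLM.hasFDerivAt.comp_hasDerivAt u hg
  refine ((h1.mul h4).sub (h2.mul h3)).congr_deriv ?_
  simp [det]; ring

theorem contDiffOn_det {E : Type*} [NormedAddCommGroup E] [NormedSpace ℝ E] {f g : E → ℂ}
    {s : Set E} (hf : ContDiffOn ℝ ∞ f s) (hg : ContDiffOn ℝ ∞ g s) :
    ContDiffOn ℝ ∞ (fun z => det (f z) (g z)) s := by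
  have h1 := Complex.reCLM.contDiff.comp_contDiffOn hf
  have h2 := Complex.imCLM.contDiff.comp_contDiffOn hf
  have h3 := Complex.reCLM.contDiff.comp_contDiffOn hg
  have h4 := Complex.imCLM.contDiff.comp_contDiffOn hg
  exact (h1.mul h4).sub (h2.mul h3)

/-- The argument is discontinuous across the negative real axis, but its class modulo `2π` is
continuous away from zero, and a periodic `f` factors through that class. -/
theorem continuous_comp_arg {f : ℝ → ℝ} (hf : Continuous f)
    (hper : Function.Periodic f (2 * Real.pi)) {z : ℂ} (hz : z ≠ 0) :
    ContinuousAt (fun z => f z.arg) z := by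
  have h1 : Continuous (hper.lift : AddCircle (2 * Real.pi) → ℝ) :=
    continuous_quot_lift _ hf
  exact ContinuousAt.comp (g := (hper.lift : Real.Angle → ℝ))
    (f := ((↑) ∘ Complex.arg : ℂ → Real.Angle)) h1.continuousAt (Complex.continuousAt_arg_coe_angle hz)

namespace IsJordanCurve

variable {x : ℝ → ℂ}

theorem exists_hasAngle (h : IsJordanCurve x) : ∃ θ, HasAngle x (speed x) (turning x) θ :=
  AnisoFlow.exists_hasAngle (h.smooth.of_le (by simpa using ENat.LEInfty.out)) h.regular

theorem turning_eq (h : IsJordanCurve x) (u : ℝ) : curvature x u * speed x u = turning x u := by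
  obtain ⟨θ, hθ⟩ := h.exists_hasAngle
  rw [hθ.curvature_eq, div_mul_cancel₀ _ (hθ.speed_pos u).ne']

theorem norm_tangent (h : IsJordanCurve x) (u : ℝ) : ‖tangent x u‖ = 1 := by
  obtain ⟨θ, hθ⟩ := h.exists_hasAngle
  rw [hθ.tangent_eq, Complex.norm_exp_ofReal_mul_I]

theorem deriv_eq (h : IsJordanCurve x) (u : ℝ) : deriv x u = speed x u • tangent x u := by
  obtain ⟨θ, hθ⟩ := h.exists_hasAngle
  rw [tangent, arcDeriv, smul_smul, mul_inv_cancel₀ (hθ.speed_pos u).ne', one_smul]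

theorem periodic_speed (h : IsJordanCurve x) : Function.Periodic (speed x) 1 := fun u => by
  simp only [speed, periodic_deriv h.periodic u]

theorem periodic_tangent (h : IsJordanCurve x) : Function.Periodic (tangent x) 1 := fun u => by
  simp only [tangent, arcDeriv, h.periodic_speed u, periodic_deriv h.periodic u]

theorem periodic_turning (h : IsJordanCurve x) : Function.Periodic (turning x) 1 := fun u => by
  simp only [turning, periodic_deriv h.periodic u, periodic_deriv (periodic_deriv h.periodic) u]

theorem det_tangent (h : IsJordanCurve x) (a b g : ℝ) (u : ℝ) :
    det (a • normal x u + b • tangent x u) (g • tangent x u) = -(a * g) := by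
  have h1 : (tangent x u).re ^ 2 + (tangent x u).im ^ 2 = 1 := by
    have := h.norm_tangent u
    rw [← sq_eq_sq₀ (norm_nonneg _) zero_le_one, Complex.sq_norm, Complex.normSq_apply] at this
    linarith
  simp only [det, normal, Complex.add_re, Complex.add_im, Complex.smul_re, Complex.smul_im,
    Complex.mul_re, Complex.mul_im, Complex.I_re, Complex.I_im, smul_eq_mul]
  linear_combination -(a * g) * h1

theorem inner_normal (h : IsJordanCurve x) (a b : ℝ) (u : ℝ) :
    inner ℝ (normal x u) (a • normal x u + b • tangent x u) = a := by
  have h1 : (tangent x u).re ^ 2 + (tangent x u).im ^ 2 = 1 := by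
    have := h.norm_tangent u
    rw [← sq_eq_sq₀ (norm_nonneg _) zero_le_one, Complex.sq_norm, Complex.normSq_apply] at this
    linarith
  simp only [Complex.inner, normal, Complex.add_re, Complex.add_im, Complex.smul_re,
    Complex.smul_im, Complex.mul_re, Complex.mul_im, Complex.I_re, Complex.I_im, smul_eq_mul,
    Complex.conj_re, Complex.conj_im]
  linear_combination a * h1

end IsJordanCurve

/-- A family of curves as a function of time and parameter. -/
def flowMap (x : ℝ → ℝ → ℂ) (q : ℝ × ℝ) : ℂ := x q.1 q.2

namespace IsGradientFlow

variable {σ : ℝ → ℝ} {T : EReal} {x : ℝ → ℝ → ℂ}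

theorem contDiffOn_flowMap (h : IsGradientFlow σ T x) :
    ContDiffOn ℝ ∞ (flowMap x) (timeInterval T ×ˢ univ) := h.smooth

theorem contDiffOn_tangent (h : IsGradientFlow σ T x) :
    ContDiffOn ℝ ∞ (partialU (flowMap x)) (timeInterval T ×ˢ univ) :=
  contDiffOn_partialU (uniqueDiffOn_timeInterval h.pos) h.contDiffOn_flowMap

theorem contDiffOn_partialU_tangent (h : IsGradientFlow σ T x) :
    ContDiffOn ℝ ∞ (partialU (partialU (flowMap x))) (timeInterval T ×ˢ univ) :=
  contDiffOn_partialU (uniqueDiffOn_timeInterval h.pos) h.contDiffOn_tangent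

theorem jordan_of_mem (h : IsGradientFlow σ T x) {t : ℝ} (ht : t ∈ openTimeInterval T) :
    IsJordanCurve (x t) := h.jordan t (openTimeInterval_subset T ht)

theorem partialU_ne_zero (h : IsGradientFlow σ T x) {q : ℝ × ℝ}
    (hq : q ∈ timeInterval T ×ˢ (univ : Set ℝ)) : partialU (flowMap x) q ≠ 0 :=
  (h.jordan q.1 hq.1).regular q.2

theorem contDiffOn_speed (h : IsGradientFlow σ T x) :
    ContDiffOn ℝ ∞ (fun q => speed (x q.1) q.2) (timeInterval T ×ˢ univ) :=
  h.contDiffOn_tangent.norm ℝ fun _ hq => h.partialU_ne_zero hq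

theorem speed_pos (h : IsGradientFlow σ T x) {q : ℝ × ℝ}
    (hq : q ∈ timeInterval T ×ˢ (univ : Set ℝ)) : 0 < speed (x q.1) q.2 :=
  norm_pos_iff.2 (h.partialU_ne_zero hq)

theorem contDiffOn_turning (h : IsGradientFlow σ T x) :
    ContDiffOn ℝ ∞ (fun q => turning (x q.1) q.2) (timeInterval T ×ˢ univ) :=
  Complex.imCLM.contDiff.comp_contDiffOn
    ((h.contDiffOn_partialU_tangent.mul (h.contDiffOn_tangent.inv
      fun _ hq => h.partialU_ne_zero hq)).congr fun _ _ => div_eq_mul_inv _ _)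

theorem contDiffOn_curvature (h : IsGradientFlow σ T x) :
    ContDiffOn ℝ ∞ (fun q => curvature (x q.1) q.2) (timeInterval T ×ˢ univ) := by
  refine (h.contDiffOn_turning.div h.contDiffOn_speed fun _ hq => (h.speed_pos hq).ne').congr
    fun q hq => ?_
  change _ = turning (x q.1) q.2 / speed (x q.1) q.2
  rw [← (h.jordan q.1 hq.1).turning_eq, mul_div_cancel_right₀ _ (h.speed_pos hq).ne']

theorem continuousOn_comp_tangentAngle (h : IsGradientFlow σ T x) {f : ℝ → ℝ} (hf : Continuous f)
    (hper : Function.Periodic f (2 * Real.pi)) :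
    ContinuousOn (fun q : ℝ × ℝ => f (tangentAngle (x q.1) q.2)) (timeInterval T ×ˢ univ) := by
  have h1 : ContinuousOn (fun q : ℝ × ℝ => tangent (x q.1) q.2) (timeInterval T ×ˢ univ) :=
    (h.contDiffOn_speed.continuousOn.inv₀ fun _ hq => (h.speed_pos hq).ne').smul
      h.contDiffOn_tangent.continuousOn
  intro q hq
  refine ContinuousAt.comp_continuousWithinAt (g := fun z : ℂ => f z.arg)
    (continuous_comp_arg hf hper ?_) (h1 q hq)
  exact norm_pos_iff.1 (by rw [(h.jordan q.1 hq.1).norm_tangent]; exact one_pos)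

theorem continuousOn_area (h : IsGradientFlow σ T x) :
    ContinuousOn (fun t => area (x t)) (timeInterval T) :=
  (continuousOn_integral (contDiffOn_det h.contDiffOn_flowMap
    h.contDiffOn_tangent).continuousOn).const_smul (1 / 2 : ℝ)

theorem continuousOn_length (h : IsGradientFlow σ T x) :
    ContinuousOn (fun t => length (x t)) (timeInterval T) := by
  simp_rw [length_eq_integral]
  exact continuousOn_integral h.contDiffOn_speed.continuousOn

theorem continuousOn_energy (h : IsGradientFlow σ T x) (hσ : Continuous σ)
    (hper : Function.Periodic σ (2 * Real.pi)) :
    ContinuousOn (fun t => energy σ (x t)) (timeInterval T) :=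
  continuousOn_integral ((h.continuousOn_comp_tangentAngle hσ hper).mul
    h.contDiffOn_speed.continuousOn)

theorem continuousOn_normalVelocity (h : IsGradientFlow σ T x) (hσ : ContDiff ℝ 2 σ)
    (hper : Function.Periodic σ (2 * Real.pi)) :
    ContinuousOn (fun q : ℝ × ℝ => normalVelocity σ (x q.1) q.2) (timeInterval T ×ˢ univ) := by
  have hσ' : Continuous (deriv (deriv σ)) :=
    (((contDiff_succ_iff_deriv (n := 1)).1 hσ).2.2).continuous_deriv le_rfl
  have h1 := h.continuousOn_comp_tangentAngle hσ.continuous hper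
  have h2 := h.continuousOn_comp_tangentAngle hσ' (periodic_deriv (periodic_deriv hper))
  have h3 : ContinuousOn (fun q : ℝ × ℝ => energy σ (x q.1) / (2 * area (x q.1)))
      (timeInterval T ×ˢ univ) := by
    have : ContinuousOn (fun t => energy σ (x t) / (2 * area (x t))) (timeInterval T) :=
      (h.continuousOn_energy hσ.continuous hper).div (h.continuousOn_area.const_smul (2 : ℝ))
        fun t ht => (mul_pos two_pos (h.jordan t ht).positive).ne'
    exact this.comp continuousOn_fst fun q hq => hq.1
  exact ((h1.add h2).mul h.contDiffOn_curvature.continuousOn).sub h3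

theorem partialT_eq (h : IsGradientFlow σ T x) {t : ℝ} (ht : t ∈ openTimeInterval T) :
    ∃ α : ℝ → ℝ, ∀ u, partialT (flowMap x) (t, u) =
      normalVelocity σ (x t) u • normal (x t) u + α u • tangent (x t) u := by
  obtain ⟨α, hα⟩ := h.evolution
  refine ⟨α t, fun u => HasDerivAt.deriv ?_⟩
  refine (hα t (openTimeInterval_subset T ht) u).hasDerivAt ?_
  exact mem_of_superset ((isOpen_openTimeInterval T).mem_nhds ht) (openTimeInterval_subset T)

theorem contDiffOn_flowMap_open (h : IsGradientFlow σ T x) :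
    ContDiffOn ℝ ∞ (flowMap x) (openTimeInterval T ×ˢ univ) :=
  h.contDiffOn_flowMap.mono (prod_mono (openTimeInterval_subset T) Subset.rfl)

theorem contDiffOn_partialU_open (h : IsGradientFlow σ T x) :
    ContDiffOn ℝ ∞ (partialU (flowMap x)) (openTimeInterval T ×ˢ univ) :=
  h.contDiffOn_tangent.mono (prod_mono (openTimeInterval_subset T) Subset.rfl)

theorem contDiffOn_partialT_open (h : IsGradientFlow σ T x) :
    ContDiffOn ℝ ∞ (partialT (flowMap x)) (openTimeInterval T ×ˢ univ) :=
  contDiffOn_partialT (isOpen_openTimeInterval T) h.contDiffOn_flowMap_open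

theorem periodic_partialT (h : IsGradientFlow σ T x) {t : ℝ} (ht : t ∈ openTimeInterval T) :
    Function.Periodic (fun u => partialT (flowMap x) (t, u)) 1 := by
  intro u
  refine EventuallyEq.deriv_eq ?_
  filter_upwards [(isOpen_openTimeInterval T).mem_nhds ht] with τ hτ
  exact (h.jordan_of_mem hτ).periodic u

/-- With `V = ∂ₜ x`, the time derivative of `det(x, x_u)` is `2 det(V, x_u)` plus the exact
derivative `∂ᵤ det(x, V)`. The first term sees only the normal part of `V`, since `det(N, T) = -1`;
the second integrates to zero. -/
theorem hasDerivAt_area (h : IsGradientFlow σ T x) {t : ℝ} (ht : t ∈ openTimeInterval T) :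
    HasDerivAt (fun t => area (x t))
      (-∫ u in (0 : ℝ)..1, normalVelocity σ (x t) u * speed (x t) u) t := by
  have hJ := isOpen_openTimeInterval T
  have hF := h.contDiffOn_flowMap_open
  have hX := h.contDiffOn_partialU_open
  have hV := h.contDiffOn_partialT_open
  have hc := h.jordan_of_mem ht
  obtain ⟨α, hα⟩ := h.partialT_eq ht
  refine ((hasDerivAt_integral hJ (contDiffOn_det hF hX) ht).const_mul (1 / 2)).congr_deriv ?_
  set V : ℝ → ℂ := fun u => partialT (flowMap x) (t, u) with hVdef
  have hVd : ∀ u, HasDerivAt V (partialU (partialT (flowMap x)) (t, u)) u := fun u =>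
    hasDerivAt_partialU hV ht u
  have hxd : ∀ u, HasDerivAt (x t) (deriv (x t) u) u := fun u => hasDerivAt_partialU hF ht u
  have hVc : Continuous V := continuous_slice hV.continuousOn ht
  have hdc : Continuous (deriv (x t)) := continuous_slice hX.continuousOn ht
  have hV'c := continuous_slice (contDiffOn_partialU hJ.uniqueDiffOn hV).continuousOn ht
  have e1 : ∀ u, partialT (fun q => det (flowMap x q) (partialU (flowMap x) q)) (t, u) =
      2 * det (V u) (deriv (x t) u) + (det (deriv (x t) u) (V u) +
        det (x t u) (partialU (partialT (flowMap x)) (t, u))) := by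
    intro u
    have h1 := hasDerivAt_det (hasDerivAt_partialT hJ hF ht u) (hasDerivAt_partialT hJ hX ht u)
    have h2 : partialT (fun q => det (flowMap x q) (partialU (flowMap x) q)) (t, u) = _ := h1.deriv
    rw [h2, partialT_partialU hJ hF ht]
    change det (V u) (deriv (x t) u) + det (x t u) _ = _
    simp only [det]; ring
  simp_rw [e1]
  have e2 : ∀ u, det (V u) (deriv (x t) u) = -(normalVelocity σ (x t) u * speed (x t) u) := by
    intro u
    rw [hc.deriv_eq, hVdef]
    simp only
    rw [hα, hc.det_tangent]
  have i1 : ∫ u in (0 : ℝ)..1, (det (deriv (x t) u) (V u) +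
      det (x t u) (partialU (partialT (flowMap x)) (t, u))) = 0 := by
    rw [intervalIntegral.integral_eq_sub_of_hasDerivAt
      (fun u _ => hasDerivAt_det (hxd u) (hVd u))]
    · have p1 := hc.periodic 0
      have p2 := h.periodic_partialT ht 0
      rw [zero_add] at p1 p2
      simp only [hVdef, p1, p2, sub_self]
    · exact ((continuous_det hdc hVc).add
        (continuous_det hc.smooth.continuous hV'c)).intervalIntegrable _ _
  rw [intervalIntegral.integral_add, i1, intervalIntegral.integral_const_mul]
  · simp_rw [e2]
    rw [intervalIntegral.integral_neg]; ring
  · exact ((continuous_det hVc hdc).const_smul (2 : ℝ)).intervalIntegrable _ _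
  · exact ((continuous_det hdc hVc).add
        (continuous_det hc.smooth.continuous hV'c)).intervalIntegrable _ _

/-- `g_t = g Re (∂ᵤ∂ₜ x / ∂ᵤ x)`, in the form `g_t = T · ∂ᵤ∂ₜ x`. -/
theorem partialT_speed (h : IsGradientFlow σ T x) {t : ℝ} (ht : t ∈ openTimeInterval T) (u : ℝ) :
    partialT (fun q => speed (x q.1) q.2) (t, u) =
      inner ℝ (tangent (x t) u) (partialU (partialT (flowMap x)) (t, u)) := by
  have hJ := isOpen_openTimeInterval T
  have hF := h.contDiffOn_flowMap_open
  have hX := h.contDiffOn_partialU_open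
  have hg : ContDiffOn ℝ ∞ (fun q : ℝ × ℝ => speed (x q.1) q.2) (openTimeInterval T ×ˢ univ) :=
    h.contDiffOn_speed.mono (prod_mono (openTimeInterval_subset T) Subset.rfl)
  have h1 := (hasDerivAt_partialT hJ hX ht u).norm_sq
  have h2 := (hasDerivAt_partialT hJ hg ht u).pow 2
  have h3 := h2.unique h1
  rw [partialT_partialU hJ hF ht] at h3
  have hpos : 0 < speed (x t) u :=
    h.speed_pos (q := (t, u)) ⟨openTimeInterval_subset T ht, mem_univ _⟩
  have e : partialU (flowMap x) (t, u) = speed (x t) u • tangent (x t) u :=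
    (h.jordan_of_mem ht).deriv_eq u
  rw [e, inner_smul_left] at h3
  simp only [Nat.cast_ofNat, Nat.add_one_sub_one, pow_one, RCLike.conj_to_real] at h3
  have h4 : (2 * speed (x t) u) ≠ 0 := by positivity
  apply mul_left_cancel₀ h4
  linarith

/-- Integration by parts of `g_t = T · V_u` with `T_u = κ N`; the tangential velocity is orthogonal
to `N` and drops out. -/
theorem hasDerivAt_length (h : IsGradientFlow σ T x) {t : ℝ} (ht : t ∈ openTimeInterval T) :
    HasDerivAt (fun t => length (x t))
      (-∫ u in (0 : ℝ)..1, turning (x t) u * normalVelocity σ (x t) u) t := by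
  have hJ := isOpen_openTimeInterval T
  have hV := h.contDiffOn_partialT_open
  have hc := h.jordan_of_mem ht
  have hg : ContDiffOn ℝ ∞ (fun q : ℝ × ℝ => speed (x q.1) q.2) (openTimeInterval T ×ˢ univ) :=
    h.contDiffOn_speed.mono (prod_mono (openTimeInterval_subset T) Subset.rfl)
  obtain ⟨α, hα⟩ := h.partialT_eq ht
  obtain ⟨θ, hθ⟩ := hc.exists_hasAngle
  simp_rw [length_eq_integral]
  refine (hasDerivAt_integral hJ hg ht).congr_deriv ?_
  simp_rw [h.partialT_speed ht]
  set V : ℝ → ℂ := fun u => partialT (flowMap x) (t, u) with hVdef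
  set V' : ℝ → ℂ := fun u => partialU (partialT (flowMap x)) (t, u) with hV'def
  have hVd : ∀ u, HasDerivAt V (V' u) u := fun u => hasDerivAt_partialU hV ht u
  have hVc : Continuous V := continuous_slice hV.continuousOn ht
  have hV'c : Continuous V' :=
    continuous_slice (contDiffOn_partialU hJ.uniqueDiffOn hV).continuousOn ht
  have hTc : Continuous (tangent (x t)) :=
    continuous_iff_continuousAt.2 fun u => (hθ.tangent_deriv u).continuousAt
  have hNc : Continuous (normal (x t)) := continuous_const.mul hTc
  have hκc := hθ.curv_cont
  have e2 : ∀ u, inner ℝ (turning (x t) u • normal (x t) u) (V u) =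
      turning (x t) u * normalVelocity σ (x t) u := by
    intro u
    simp only [hVdef]
    rw [inner_smul_left, hα, hc.inner_normal]
    simp
  have i1 : ∫ u in (0 : ℝ)..1, (inner ℝ (tangent (x t) u) (V' u) +
      inner ℝ (turning (x t) u • normal (x t) u) (V u)) = 0 := by
    rw [intervalIntegral.integral_eq_sub_of_hasDerivAt
      (fun u _ => (hθ.tangent_deriv u).inner ℝ (hVd u))
      (by apply Continuous.intervalIntegrable; fun_prop)]
    have p1 := hc.periodic_tangent 0
    have p2 := h.periodic_partialT ht 0
    rw [zero_add] at p1 p2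
    simp only [hVdef, p1, p2, sub_self]
  rw [intervalIntegral.integral_add (by apply Continuous.intervalIntegrable; fun_prop)
    (by apply Continuous.intervalIntegrable; fun_prop)] at i1
  simp_rw [← e2]
  linarith

end IsGradientFlow

/-! ### Convexity is preserved by the isoperimetric ratio gradient flow -/

/-- A negative second derivative would make the point a local maximum as well, so `f` would be
locally constant with second derivative zero. -/
theorem deriv_deriv_nonneg_of_isLocalMin {f : ℝ → ℝ} {a : ℝ} (h : IsLocalMin f a)
    (hf : ContinuousAt f a) : 0 ≤ deriv (deriv f) a := by
  by_contra! hneg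
  have hmax := isLocalMax_of_deriv_deriv_neg hneg h.deriv_eq_zero hf
  have hc : f =ᶠ[𝓝 a] fun _ => f a := by
    filter_upwards [h, hmax] with y h1 h2 using le_antisymm h2 h1
  have h0 : deriv (deriv f) a = 0 := by
    rw [hc.deriv.deriv_eq]; simp
  exact hneg.ne h0

theorem hasDerivAt_nonpos_of_isMinOn_Icc {f : ℝ → ℝ} {a b d : ℝ} (hab : a < b)
    (h : IsMinOn f (Icc a b) b) (hd : HasDerivAt f d b) : d ≤ 0 := by
  have h1 : a - b ∈ posTangentConeAt (Icc a b) b :=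
    sub_mem_posTangentConeAt_of_segment_subset (by rw [segment_symm, segment_eq_Icc hab.le])
  have h2 := h.localize.hasFDerivWithinAt_nonneg hd.hasFDerivAt.hasFDerivWithinAt h1
  simp only [ContinuousLinearMap.toSpanSingleton_apply, smul_eq_mul] at h2
  nlinarith

/-- The signed distance to the tangent line at `u` is minimal at `u`, and its second derivative
there is `turning x u * speed x u`. -/
theorem IsConvexCurve.turning_nonneg {x : ℝ → ℂ} (h : IsConvexCurve x) (hx : IsJordanCurve x)
    (u : ℝ) : 0 ≤ turning x u := by
  have h2 : ContDiff ℝ 2 x := hx.smooth.of_le (by simpa using ENat.LEInfty.out)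
  have h1 : ContDiff ℝ 1 (deriv x) := ((contDiff_succ_iff_deriv (n := 1)).1 h2).2.2
  have hd : ∀ v, HasDerivAt x (deriv x v) v := fun v =>
    (h2.differentiable (by norm_num) v).hasDerivAt
  have hd2 : ∀ v, HasDerivAt (deriv x) (deriv (deriv x) v) v := fun v =>
    (h1.differentiable (by norm_num) v).hasDerivAt
  have e1 : ∀ v, HasDerivAt (fun v => inner ℝ (x v - x u) (normal x u))
      (inner ℝ (deriv x v) (normal x u)) v := fun v => by
    simpa using ((hd v).sub_const (x u)).inner ℝ (hasDerivAt_const v (normal x u))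
  have e2 : HasDerivAt (fun v => inner ℝ (deriv x v) (normal x u))
      (inner ℝ (deriv (deriv x) u) (normal x u)) u := by
    simpa using (hd2 u).inner ℝ (hasDerivAt_const u (normal x u))
  have hmin : IsLocalMin (fun v => inner ℝ (x v - x u) (normal x u)) u :=
    Eventually.of_forall fun v => by simpa using h u v
  have h3 := deriv_deriv_nonneg_of_isLocalMin hmin (e1 u).continuousAt
  rw [funext fun v => (e1 v).deriv, e2.deriv] at h3
  have hg : 0 < speed x u := norm_pos_iff.2 (hx.regular u)
  have h4 : inner ℝ (deriv (deriv x) u) (normal x u) = turning x u * speed x u := by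
    have e3 : deriv (deriv x) u = (deriv (deriv x) u / deriv x u) * deriv x u :=
      (div_mul_cancel₀ _ (hx.regular u)).symm
    have hT : (tangent x u).re ^ 2 + (tangent x u).im ^ 2 = 1 := by
      have := hx.norm_tangent u
      rw [← sq_eq_sq₀ (norm_nonneg _) zero_le_one, Complex.sq_norm, Complex.normSq_apply] at this
      linarith
    rw [turning, e3]
    generalize deriv (deriv x) u / deriv x u = ψ
    rw [hx.deriv_eq]
    simp only [Complex.inner, normal, Complex.mul_re, Complex.mul_im, Complex.conj_re,
      Complex.conj_im, Complex.I_re, Complex.I_im, Complex.smul_re, Complex.smul_im, smul_eq_mul]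
    have hz : (speed x u • tangent x u : ℂ) ≠ 0 := by rw [← hx.deriv_eq]; exact hx.regular u
    rw [mul_div_cancel_right₀ _ hz]
    linear_combination (ψ.im * speed x u) * hT
  rw [h4] at h3
  exact nonneg_of_mul_nonneg_left h3 hg

theorem normalVelocity_one (x : ℝ → ℂ) (u : ℝ) :
    normalVelocity (fun _ => 1) x u = curvature x u - length x / (2 * area x) := by
  simp [normalVelocity, anisoCurvature, energy, length]

namespace IsGradientFlow

variable {T : EReal} {x : ℝ → ℝ → ℂ}

/-- The evolution equation of the curvature, at a critical point of the curvature. -/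
theorem partialT_curvature (h : IsGradientFlow (fun _ => 1) T x) {t : ℝ}
    (ht : t ∈ openTimeInterval T) {u : ℝ} (hu : deriv (curvature (x t)) u = 0) :
    partialT (fun q => curvature (x q.1) q.2) (t, u) =
      deriv (deriv (curvature (x t))) u / speed (x t) u ^ 2 +
        curvature (x t) u ^ 2 * (curvature (x t) u - length (x t) / (2 * area (x t))) := by
  have hJ := isOpen_openTimeInterval T
  have hsub : openTimeInterval T ×ˢ (univ : Set ℝ) ⊆ timeInterval T ×ˢ univ :=
    prod_mono (openTimeInterval_subset T) Subset.rfl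
  have hF := h.contDiffOn_flowMap_open
  have hX := h.contDiffOn_partialU_open
  have hX2 := h.contDiffOn_partialU_tangent.mono hsub
  have hV := h.contDiffOn_partialT_open
  have hV' := contDiffOn_partialU hJ.uniqueDiffOn hV
  have hg := h.contDiffOn_speed.mono hsub
  have hκ := h.contDiffOn_turning.mono hsub
  have hK := h.contDiffOn_curvature.mono hsub
  have hK' := contDiffOn_partialU hJ.uniqueDiffOn hK
  have hc := h.jordan_of_mem ht
  obtain ⟨α, hα⟩ := h.partialT_eq ht
  obtain ⟨θ, hθ⟩ := hc.exists_hasAngle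
  set V : ℝ → ℂ := fun u => partialT (flowMap x) (t, u) with hVdef
  set V' : ℝ → ℂ := fun u => partialU (partialT (flowMap x)) (t, u) with hV'def
  set V'' : ℝ → ℂ := fun u => partialU (partialU (partialT (flowMap x))) (t, u) with hV''def
  set c : ℝ := length (x t) / (2 * area (x t)) with hcdef
  set k : ℝ → ℝ := curvature (x t) with hk
  set g : ℝ → ℝ := speed (x t) with hgdef
  set τ : ℝ → ℂ := tangent (x t) with hτdef
  have hVd : ∀ u, HasDerivAt V (V' u) u := fun u => hasDerivAt_partialU hV ht u
  have hV'd : ∀ u, HasDerivAt V' (V'' u) u := fun u => hasDerivAt_partialU hV' ht u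
  have hkd : ∀ u, HasDerivAt k (deriv k u) u := fun u => hasDerivAt_partialU hK ht u
  have hk'd : ∀ u, HasDerivAt (deriv k) (deriv (deriv k) u) u := fun u =>
    hasDerivAt_partialU hK' ht u
  have hgd : ∀ u, HasDerivAt g (deriv g u) u := fun u => hasDerivAt_partialU hg ht u
  have hXd : ∀ u, HasDerivAt (deriv (x t)) (deriv (deriv (x t)) u) u := fun u =>
    hasDerivAt_partialU hX ht u
  have hg0 : ∀ u, g u ≠ 0 := fun u => (hθ.speed_pos u).ne'
  have hT : ∀ u, (τ u).re ^ 2 + (τ u).im ^ 2 = 1 := fun u => by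
    have := hc.norm_tangent u
    rw [← sq_eq_sq₀ (norm_nonneg _) zero_le_one, Complex.sq_norm, Complex.normSq_apply] at this
    linarith
  have hτ0 : ∀ u, τ u ≠ 0 := fun u => norm_pos_iff.1 (by rw [hc.norm_tangent]; exact one_pos)
  have hτd : ∀ u, HasDerivAt τ (k u * g u * Complex.I * τ u : ℂ) u := fun u => by
    refine (hθ.tangent_deriv u).congr_deriv ?_
    rw [← hc.turning_eq, Complex.real_smul, normal]; push_cast; ring
  have hX0 : ∀ u, deriv (x t) u = g u * τ u := fun u => by
    rw [hc.deriv_eq, Complex.real_smul]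
  have hVeq : ∀ u, V u = (α u + (k u - c : ℝ) * Complex.I) * τ u := fun u => by
    simp only [hVdef]
    rw [hα, normalVelocity_one, Complex.real_smul, Complex.real_smul, normal]; ring
  -- the tangential velocity is differentiable
  obtain ⟨α', hαd⟩ : ∃ α' : ℝ → ℝ, ∀ u, HasDerivAt α (α' u) u := by
    have e : α = fun u => (V u / τ u).re := by
      funext u
      rw [hVeq, mul_div_cancel_right₀ _ (hτ0 u)]
      simp
    rw [e]
    exact ⟨_, fun u => Complex.reCLM.hasFDerivAt.comp_hasDerivAt u ((hVd u).div (hτd u) (hτ0 u))⟩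
  -- `η` is the time derivative of `log x_u`: its real part is `g_t / g` and its imaginary part the
  -- rate of change of the tangent angle. Hence `Im η_u` is the time derivative of `turning`.
  set η : ℝ → ℂ := fun u => V' u / deriv (x t) u with hη
  have hηeq : ∀ u, η u = ((α' u - (k u - c) * (k u * g u)) / g u : ℝ) +
      (deriv k u / g u + α u * k u : ℝ) * Complex.I := fun u => by
    have h1 : HasDerivAt V ((α' u + (deriv k u : ℝ) * Complex.I) * τ u +
        (α u + (k u - c : ℝ) * Complex.I) * (k u * g u * Complex.I * τ u)) u := by
      rw [funext hVeq]
      exact (((hαd u).ofReal_comp.add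
        (((hkd u).sub_const c).ofReal_comp.mul_const Complex.I))).mul (hτd u)
    have h2 := (hVd u).unique h1
    have h3 : (g u : ℂ) ≠ 0 := Complex.ofReal_ne_zero.2 (hg0 u)
    have h4 := hτ0 u
    simp only [hη, h2, hX0]
    push_cast
    field_simp
    linear_combination ((k u : ℂ) - c) * k u * g u * Complex.I_sq
  have hηd : HasDerivAt η
      ((V'' u * deriv (x t) u - V' u * deriv (deriv (x t)) u) / deriv (x t) u ^ 2) u :=
    (hV'd u).div (hXd u) (hc.regular u)
  have hηim : ((V'' u * deriv (x t) u - V' u * deriv (deriv (x t)) u) / deriv (x t) u ^ 2).im =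
      deriv (deriv k) u / g u + α' u * k u := by
    have h1 := Complex.imCLM.hasFDerivAt.comp_hasDerivAt u hηd
    have h2 : HasDerivAt (fun u => deriv k u / g u + α u * k u)
        ((deriv (deriv k) u * g u - deriv k u * deriv g u) / g u ^ 2 +
          (α' u * k u + α u * deriv k u)) u :=
      ((hk'd u).div (hgd u) (hg0 u)).add ((hαd u).mul (hkd u))
    have h3 : (fun u => deriv k u / g u + α u * k u) = Complex.imCLM ∘ η := by
      funext u; simp [hηeq]
    rw [h3] at h2
    have h4 := h1.unique h2
    have h5 := hg0 u
    rw [hu] at h4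
    refine h4.trans ?_
    field_simp; ring
  -- time derivatives
  have hXt : ∀ v, partialT (partialU (flowMap x)) (t, v) = V' v := fun v =>
    partialT_partialU hJ hF ht
  have hX2t : partialT (partialU (partialU (flowMap x))) (t, u) = V'' u := by
    rw [partialT_partialU hJ hX ht]
    change deriv (fun v => partialT (partialU (flowMap x)) (t, v)) u = deriv V' u
    simp_rw [hXt]
  have hψt : HasDerivAt (fun s => turning (x s) u) (deriv (deriv k) u / g u + α' u * k u) t := by
    have h1 := (hasDerivAt_partialT hJ hX2 ht u).div (hasDerivAt_partialT hJ hX ht u)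
      (hc.regular u)
    rw [hXt, hX2t] at h1
    rw [← hηim]
    refine (Complex.imCLM.hasFDerivAt.comp_hasDerivAt t h1).congr_deriv ?_
    change ((V'' u * deriv (x t) u - deriv (deriv (x t)) u * V' u) / deriv (x t) u ^ 2).im = _
    rw [mul_comm (deriv (deriv (x t)) u)]
  have hgt : HasDerivAt (fun s => speed (x s) u) (α' u - (k u - c) * (k u * g u)) t := by
    refine (hasDerivAt_partialT hJ hg ht u).congr_deriv ?_
    rw [h.partialT_speed ht]
    have h1 : V' u = η u * (g u * τ u) := by
      rw [← hX0]; exact (div_mul_cancel₀ _ (hc.regular u)).symm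
    change inner ℝ (τ u) (V' u) = _
    have h2 : (η u).re = (α' u - (k u - c) * (k u * g u)) / g u := by rw [hηeq]; simp
    have h3 : α' u - (k u - c) * (k u * g u) = (η u).re * g u := by
      rw [h2, div_mul_cancel₀ _ (hg0 u)]
    rw [h1, h3]
    simp only [Complex.inner, Complex.mul_re, Complex.mul_im, Complex.conj_re, Complex.conj_im,
      Complex.ofReal_re, Complex.ofReal_im]
    linear_combination (η u).re * g u * hT u
  have hKt : HasDerivAt (fun s => turning (x s) u / speed (x s) u)
      (((deriv (deriv k) u / g u + α' u * k u) * g u -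
        turning (x t) u * (α' u - (k u - c) * (k u * g u))) / g u ^ 2) t :=
    hψt.div hgt (hg0 u)
  have hKeq : (fun s => curvature (x s) u) =ᶠ[𝓝 t] fun s => turning (x s) u / speed (x s) u := by
    filter_upwards [hJ.mem_nhds ht] with s hs
    have hcs := h.jordan_of_mem hs
    rw [← hcs.turning_eq, mul_div_cancel_right₀]
    exact (norm_pos_iff.2 (hcs.regular u)).ne'
  have := (hKt.congr_of_eventuallyEq hKeq).deriv
  change deriv (fun s => curvature (x s) u) t = _
  rw [this, ← hc.turning_eq]
  change ((deriv (deriv k) u / g u + α' u * k u) * g u -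
        (k u * g u) * (α' u - (k u - c) * (k u * g u))) / g u ^ 2 = _
  have := hg0 u
  field_simp
  ring

/-- Maximum principle. At a spatial minimum the curvature satisfies `k_t ≥ k · k (k - L/(2A))`, and
the factor `k (k - L/(2A))` is bounded on compact time intervals; an exponential weight absorbs it.
-/
theorem curvature_nonneg (h : IsGradientFlow (fun _ => 1) T x)
    (h0 : ∀ u, 0 ≤ curvature (x 0) u) {t : ℝ} (ht : t ∈ timeInterval T) (u : ℝ) :
    0 ≤ curvature (x t) u := by
  by_contra! hneg
  have hJ := isOpen_openTimeInterval T
  have hsub : Icc 0 t ⊆ timeInterval T := fun s hs =>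
    ⟨hs.1, lt_of_le_of_lt (EReal.coe_le_coe_iff.2 hs.2) ht.2⟩
  have hKc : ContinuousOn (fun q : ℝ × ℝ => curvature (x q.1) q.2) (timeInterval T ×ˢ univ) :=
    h.contDiffOn_curvature.continuousOn
  have hper : ∀ s ∈ timeInterval T, Function.Periodic (curvature (x s)) 1 := fun s hs v => by
    have hc := h.jordan s hs
    have e : ∀ v, curvature (x s) v = turning (x s) v / speed (x s) v := fun v => by
      rw [← hc.turning_eq, mul_div_cancel_right₀]
      exact (norm_pos_iff.2 (hc.regular v)).ne'
    rw [e, e, hc.periodic_turning, hc.periodic_speed]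
  have hcc : ContinuousOn (fun q : ℝ × ℝ => length (x q.1) / (2 * area (x q.1)))
      (timeInterval T ×ˢ univ) := by
    have : ContinuousOn (fun t => length (x t) / (2 * area (x t))) (timeInterval T) :=
      h.continuousOn_length.div (h.continuousOn_area.const_smul (2 : ℝ))
        fun t ht => (mul_pos two_pos (h.jordan t ht).positive).ne'
    exact this.comp continuousOn_fst fun q hq => hq.1
  set Q : Set (ℝ × ℝ) := Icc 0 t ×ˢ Icc 0 1 with hQ
  have hQc : IsCompact Q := isCompact_Icc.prod isCompact_Icc
  have hQsub : Q ⊆ timeInterval T ×ˢ univ := prod_mono hsub (subset_univ _)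
  obtain ⟨M, hM⟩ := hQc.exists_bound_of_continuousOn ((hKc.mul (hKc.sub hcc)).mono hQsub)
  -- The rate `M + 1` exceeds the bound `M`, so at a negative minimum of `w` at positive time the
  -- time derivative would be strictly positive, while minimality over earlier times makes it
  -- nonpositive.
  set w : ℝ × ℝ → ℝ := fun q => Real.exp (-(M + 1) * q.1) * curvature (x q.1) q.2 with hw
  have hwc : ContinuousOn w Q := ContinuousOn.mul (by fun_prop) (hKc.mono hQsub)
  obtain ⟨u', hu', huu'⟩ := (hper t ht).exists_mem_Ico₀ one_pos u
  rw [huu'] at hneg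
  have hmem : (t, u') ∈ Q := ⟨⟨ht.1, le_rfl⟩, ⟨hu'.1, hu'.2.le⟩⟩
  obtain ⟨⟨s, v⟩, hsv, hmin⟩ := hQc.exists_isMinOn ⟨_, hmem⟩ hwc
  have hwneg : w (s, v) < 0 :=
    lt_of_le_of_lt (hmin hmem) (mul_neg_of_pos_of_neg (Real.exp_pos _) hneg)
  have hkneg : curvature (x s) v < 0 := by
    by_contra! hcon
    exact absurd hwneg (not_lt.2 (mul_nonneg (Real.exp_pos _).le hcon))
  have hs0 : 0 < s := by
    rcases eq_or_lt_of_le hsv.1.1 with hs | hs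
    · simp only at hs
      rw [← hs] at hkneg
      exact absurd (h0 v) (not_le.2 hkneg)
    · exact hs
  have hsJ : s ∈ openTimeInterval T := ⟨hs0, (hsub hsv.1).2⟩
  have hK := h.contDiffOn_curvature.mono
    (prod_mono (openTimeInterval_subset T) (Subset.refl univ))
  have hmin_u : ∀ v', curvature (x s) v ≤ curvature (x s) v' := by
    intro v'
    obtain ⟨y, hy, hyv⟩ := (hper s (hsub hsv.1)).exists_mem_Ico₀ one_pos v'
    rw [hyv]
    have : w (s, v) ≤ w (s, y) := hmin ⟨hsv.1, ⟨hy.1, hy.2.le⟩⟩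
    exact le_of_mul_le_mul_left this (Real.exp_pos _)
  have hlm : IsLocalMin (curvature (x s)) v := Eventually.of_forall hmin_u
  have hdd := deriv_deriv_nonneg_of_isLocalMin hlm (hasDerivAt_partialU hK hsJ v).continuousAt
  have hKt := hasDerivAt_partialT hJ hK hsJ v
  rw [h.partialT_curvature hsJ hlm.deriv_eq_zero] at hKt
  have hexp : HasDerivAt (fun r : ℝ => Real.exp (-(M + 1) * r))
      (Real.exp (-(M + 1) * s) * (-(M + 1))) s := by
    simpa using ((hasDerivAt_id s).const_mul (-(M + 1))).exp
  have hwt := hexp.mul hKt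
  have hle := hasDerivAt_nonpos_of_isMinOn_Icc hs0 (f := fun r => w (r, v))
    (fun r hr => hmin ⟨⟨hr.1, hr.2.trans hsv.1.2⟩, hsv.2⟩) hwt
  have hb : curvature (x s) v * (curvature (x s) v - length (x s) / (2 * area (x s))) ≤ M :=
    (le_abs_self _).trans (hM (s, v) hsv)
  have he := Real.exp_pos (-(M + 1) * s)
  set k := curvature (x s) v
  set c := length (x s) / (2 * area (x s))
  have hq : 0 ≤ deriv (deriv (curvature (x s))) v / speed (x s) v ^ 2 := by positivity
  set D := deriv (deriv (curvature (x s))) v / speed (x s) v ^ 2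
  have e : Real.exp (-(M + 1) * s) * -(M + 1) * k + Real.exp (-(M + 1) * s) * (D + k ^ 2 * (k - c))
      = Real.exp (-(M + 1) * s) * (D + (-k) * (M + 1 - k * (k - c))) := by ring
  rw [e] at hle
  have : 0 < Real.exp (-(M + 1) * s) * (D + (-k) * (M + 1 - k * (k - c))) := by
    refine mul_pos he (add_pos_of_nonneg_of_pos hq (mul_pos (by linarith) (by linarith)))
  linarith

end IsGradientFlow

namespace HasAngle

variable {x : ℝ → ℂ} {g θ : ℝ → ℝ}

/-- Nonnegative curvature rules out the value `-2π` in the Umlaufsatz. -/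
theorem angle_add_one (h : HasAngle x g (turning x) θ) (hx : IsJordanCurve x)
    (hκ : ∀ u, 0 ≤ turning x u) (u : ℝ) : θ (u + 1) = θ u + 2 * Real.pi := by
  have h1 : ∫ u in (0 : ℝ)..1, turning x u = 2 * Real.pi := by
    have h2 := intervalIntegral.integral_nonneg (μ := volume) (zero_le_one' ℝ) fun u _ => hκ u
    have hpi := Real.pi_pos
    refine (integral_turning_eq (hx.smooth.of_le (by simpa using ENat.LEInfty.out)) hx.periodic
      hx.regular hx.simple).resolve_right fun h3 => ?_
    linarith
  have h3 := hx.periodic_turning.intervalIntegral_add_eq 0 u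
  rw [zero_add, h1, intervalIntegral.integral_eq_sub_of_hasDerivAt (fun u _ => h.angle u)
    (h.curv_cont.intervalIntegrable _ _)] at h3
  linarith

theorem integral_turning (h : HasAngle x g (turning x) θ) (hx : IsJordanCurve x)
    (hκ : ∀ u, 0 ≤ turning x u) : ∫ u in (0 : ℝ)..1, turning x u = 2 * Real.pi := by
  rw [intervalIntegral.integral_eq_sub_of_hasDerivAt (fun u _ => h.angle u)
    (h.curv_cont.intervalIntegrable _ _)]
  have := h.angle_add_one hx hκ 0
  rw [zero_add] at this
  linarith

end HasAngle

/-! ### The isoperimetric ratio gradient flow -/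

namespace IsGradientFlow

variable {T : EReal} {x : ℝ → ℝ → ℂ}

/-- `A' = L²/(2A) - ∫ k ds`. Either value in the Umlaufsatz is at most `2π`, and `L²/(2A) ≥ 2π` is
the isoperimetric inequality. -/
theorem monotoneOn_area (h : IsGradientFlow (fun _ => 1) T x) :
    MonotoneOn (fun t => area (x t)) (timeInterval T) := by
  refine monotoneOn_of_deriv_nonneg (ordConnected_timeInterval T).convex h.continuousOn_area ?_ ?_
  · rw [interior_timeInterval]
    exact fun t ht => (h.hasDerivAt_area ht).differentiableAt.differentiableWithinAt
  · rw [interior_timeInterval]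
    intro t ht
    have hc := h.jordan_of_mem ht
    obtain ⟨θ, hθ⟩ := hc.exists_hasAngle
    have hgc := hθ.speed_cont
    have hκc := hθ.curv_cont
    have hA := hc.positive
    have h2 : ContDiff ℝ 2 (x t) := hc.smooth.of_le (by simpa using ENat.LEInfty.out)
    have hiso := isoperimetric_inequality (h2.of_le (by norm_num)) hc.periodic hc.regular
    have htot : ∫ u in (0 : ℝ)..1, turning (x t) u ≤ 2 * Real.pi := by
      have := Real.pi_pos
      rcases integral_turning_eq h2 hc.periodic hc.regular hc.simple with h | h <;> rw [h]
      linarith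
    rw [(h.hasDerivAt_area ht).deriv]
    simp_rw [normalVelocity_one, sub_mul, hc.turning_eq]
    rw [intervalIntegral.integral_sub (by apply Continuous.intervalIntegrable; fun_prop)
      (by apply Continuous.intervalIntegrable; fun_prop), intervalIntegral.integral_const_mul,
      ← length_eq_integral]
    have : 2 * Real.pi ≤ length (x t) / (2 * area (x t)) * length (x t) := by
      rw [div_mul_eq_mul_div, le_div_iff₀ (by positivity)]
      linarith
    linarith

/-- Once `k ≥ 0` is known at all times, `L' = π L / A - ∫ k² ds`, and its sign is Gage's inequality.
-/
theorem antitoneOn_length (h : IsGradientFlow (fun _ => 1) T x) (hconv : IsConvexCurve (x 0)) :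
    AntitoneOn (fun t => length (x t)) (timeInterval T) := by
  have hx0 := h.jordan 0 (zero_mem_timeInterval h.pos)
  have h0 : ∀ u, 0 ≤ curvature (x 0) u := fun u => by
    have h1 := hconv.turning_nonneg hx0 u
    rw [← hx0.turning_eq] at h1
    exact nonneg_of_mul_nonneg_left h1 (norm_pos_iff.2 (hx0.regular u))
  refine antitoneOn_of_deriv_nonpos (ordConnected_timeInterval T).convex h.continuousOn_length ?_ ?_
  · rw [interior_timeInterval]
    exact fun t ht => (h.hasDerivAt_length ht).differentiableAt.differentiableWithinAt
  · rw [interior_timeInterval]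
    intro t ht
    have hc := h.jordan_of_mem ht
    obtain ⟨θ, hθ⟩ := hc.exists_hasAngle
    have hgc := hθ.speed_cont
    have hκc := hθ.curv_cont
    have hg0 : ∀ u, speed (x t) u ≠ 0 := fun u => (hθ.speed_pos u).ne'
    have hA := hc.positive
    have hκ : ∀ u, 0 ≤ turning (x t) u := fun u => by
      rw [← hc.turning_eq]
      exact mul_nonneg (h.curvature_nonneg h0 (openTimeInterval_subset T ht) u)
        (hθ.speed_pos u).le
    have hgage := hθ.gage_inequality hκ hc.periodic hc.periodic_speed (hθ.angle_add_one hc hκ) hA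
    rw [← length_eq_integral] at hgage
    have e : ∀ u, turning (x t) u * normalVelocity (fun _ => 1) (x t) u =
        turning (x t) u ^ 2 / speed (x t) u
          - length (x t) / (2 * area (x t)) * turning (x t) u := fun u => by
      rw [normalVelocity_one, hθ.curvature_eq]; ring
    rw [(h.hasDerivAt_length ht).deriv]
    simp_rw [e]
    rw [intervalIntegral.integral_sub
      (by apply Continuous.intervalIntegrable; fun_prop (disch := assumption))
      (by apply Continuous.intervalIntegrable; fun_prop), intervalIntegral.integral_const_mul,
      hθ.integral_turning hc hκ]
    have : length (x t) / (2 * area (x t)) * (2 * Real.pi) =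
        Real.pi / area (x t) * length (x t) := by field_simp
    linarith

end IsGradientFlow

/-! ### Curves that parametrize the boundary of a Wulff shape -/

theorem mem_wulffShape {σ : ℝ → ℝ} {z : ℂ} :
    z ∈ wulffShape σ ↔ ∀ ν, z.re * Real.sin ν - z.im * Real.cos ν ≤ σ ν := by
  simp only [wulffShape, mem_iInter, mem_ofPred_eq]
  refine forall_congr' fun ν => ?_
  have : -(inner ℝ z (⟨-Real.sin ν, Real.cos ν⟩ : ℂ)) = z.re * Real.sin ν - z.im * Real.cos ν := by
    simp only [Complex.inner, Complex.mul_re, Complex.conj_re, Complex.conj_im]; ring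
  rw [this]

theorem isClosed_wulffShape (σ : ℝ → ℝ) : IsClosed (wulffShape σ) := by
  refine isClosed_iInter fun ν => isClosed_le ?_ continuous_const
  exact (continuous_id.inner continuous_const).neg

/-- Every boundary point of a Wulff shape lies on one of the lines that bound its half planes. -/
theorem exists_eq_of_mem_frontier_wulffShape {σ : ℝ → ℝ} (hσ : Continuous σ)
    (hper : Function.Periodic σ (2 * Real.pi)) {z : ℂ} (hz : z ∈ frontier (wulffShape σ)) :
    ∃ ν, z.re * Real.sin ν - z.im * Real.cos ν = σ ν := by
  have hzW : z ∈ wulffShape σ := (isClosed_wulffShape σ).frontier_subset hz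
  rw [mem_wulffShape] at hzW
  by_contra! hne
  obtain ⟨ν₀, -, hmin⟩ := isCompact_Icc.exists_isMinOn
    (nonempty_Icc.2 Real.two_pi_pos.le)
    (f := fun ν => σ ν - (z.re * Real.sin ν - z.im * Real.cos ν))
    (Continuous.continuousOn (by fun_prop))
  set δ := σ ν₀ - (z.re * Real.sin ν₀ - z.im * Real.cos ν₀) with hδ
  have hδ0 : 0 < δ := sub_pos.2 (lt_of_le_of_ne (hzW ν₀) (hne ν₀))
  have hall : ∀ ν, z.re * Real.sin ν - z.im * Real.cos ν + δ ≤ σ ν := by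
    intro ν
    have hp : Function.Periodic (fun ν => σ ν - (z.re * Real.sin ν - z.im * Real.cos ν))
        (2 * Real.pi) := fun ν => by
      simp only [hper ν, Real.sin_add_two_pi, Real.cos_add_two_pi]
    obtain ⟨μ, hμ, hμ2⟩ := hp.exists_mem_Ico₀ Real.two_pi_pos ν
    have : δ ≤ σ μ - (z.re * Real.sin μ - z.im * Real.cos μ) := hmin ⟨hμ.1, hμ.2.le⟩
    linarith
  have hball : Metric.ball z δ ⊆ wulffShape σ := by
    intro y hy
    rw [mem_wulffShape]
    intro ν
    have h1 : ‖y - z‖ < δ := by rwa [Metric.mem_ball, dist_eq_norm] at hy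
    have h2 : (y - z).re * Real.sin ν - (y - z).im * Real.cos ν ≤ ‖y - z‖ := by
      refine abs_le_of_sq_le_sq' ?_ (norm_nonneg _) |>.2
      rw [Complex.sq_norm, Complex.normSq_apply]
      have := Real.sin_sq_add_cos_sq ν
      nlinarith [sq_nonneg ((y - z).re * Real.cos ν + (y - z).im * Real.sin ν)]
    have h3 := hall ν
    simp only [Complex.sub_re, Complex.sub_im] at h2
    linarith
  exact hz.2 (mem_interior.2 ⟨_, hball, Metric.isOpen_ball, Metric.mem_ball_self hδ0⟩)

section wulff

variable {σ : ℝ → ℝ} {x : ℝ → ℂ} {κ θ : ℝ → ℝ} {p : ℂ} {r : ℝ}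

/-- Each point of the curve lies on a bounding line of the scaled Wulff shape, and the curve stays
on one side of that line, so the line is tangent: `ν` equals `θ u` modulo `π`. Even multiples of `π`
give the claim; odd ones mean that the support function is negative. -/
theorem supportFn_eq_of_range_eq (hσ : Continuous σ) (hper : Function.Periodic σ (2 * Real.pi))
    (hpos : ∀ ν, 0 < σ ν) (h : HasAngle x (speed x) κ θ) (hx : IsJordanCurve x) (hr : 0 < r)
    (hrange : range x ⊆ (fun z : ℂ => p + r • z) '' frontier (wulffShape σ)) :
    (∀ u ν, (x u - p).re * Real.sin ν - (x u - p).im * Real.cos ν ≤ r * σ ν) ∧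
      ∀ u, supportFn x θ p u = r * σ (θ u) := by
  have hz : ∀ u, ∃ z ∈ frontier (wulffShape σ), x u - p = r • z := fun u => by
    obtain ⟨z, hz, hzu⟩ := hrange (mem_range_self u)
    exact ⟨z, hz, by rw [← hzu]; simp⟩
  have hle : ∀ u ν, (x u - p).re * Real.sin ν - (x u - p).im * Real.cos ν ≤ r * σ ν := by
    intro u ν
    obtain ⟨z, hz, hzu⟩ := hz u
    have := mem_wulffShape.1 ((isClosed_wulffShape σ).frontier_subset hz) ν
    rw [hzu, Complex.smul_re, Complex.smul_im, smul_eq_mul, smul_eq_mul]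
    nlinarith
  refine ⟨hle, ?_⟩
  have halt : ∀ u, supportFn x θ p u = r * σ (θ u) ∨ supportFn x θ p u < 0 := by
    intro u
    obtain ⟨z, hz, hzu⟩ := hz u
    obtain ⟨ν, hν⟩ := exists_eq_of_mem_frontier_wulffShape hσ hper hz
    have heq : (x u - p).re * Real.sin ν - (x u - p).im * Real.cos ν = r * σ ν := by
      rw [hzu, Complex.smul_re, Complex.smul_im, smul_eq_mul, smul_eq_mul, ← hν]; ring
    have hmin : IsLocalMin
        (fun v => r * σ ν - (((x v).re - p.re) * Real.sin ν - ((x v).im - p.im) * Real.cos ν)) u :=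
      Eventually.of_forall fun v => by
        have := hle v ν
        simp only [Complex.sub_re, Complex.sub_im] at this heq ⊢
        linarith
    have hd := (((h.re_deriv u).sub_const p.re).mul_const (Real.sin ν)).sub
      (((h.im_deriv u).sub_const p.im).mul_const (Real.cos ν)) |>.const_sub (r * σ ν)
    have h0 := hmin.hasDerivAt_eq_zero hd
    have hsin : Real.sin (ν - θ u) = 0 := by
      have hg := (h.speed_pos u).ne'
      apply mul_left_cancel₀ hg
      rw [Real.sin_sub]; linarith
    obtain ⟨n, hn⟩ := Real.sin_eq_zero_iff.1 hsin
    have hν' : ν = θ u + n * Real.pi := by linarith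
    rcases Int.even_or_odd' n with ⟨m, rfl | rfl⟩
    · left
      have e : ν = θ u + m • (2 * Real.pi) := by rw [hν', zsmul_eq_mul]; push_cast; ring
      rw [e, (Real.sin_periodic.zsmul m), (Real.cos_periodic.zsmul m), (hper.zsmul m)] at heq
      exact heq
    · right
      have e : ν = θ u + Real.pi + m • (2 * Real.pi) := by
        rw [hν', zsmul_eq_mul]; push_cast; ring
      have hpos' := mul_pos hr (hpos ν)
      rw [← heq, e, (Real.sin_periodic.zsmul m), (Real.cos_periodic.zsmul m), Real.sin_add_pi,
        Real.cos_add_pi] at hpos'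
      rw [supportFn]; linarith
  have hsc := h.support_cont p
  -- Positive area makes the support function positive somewhere. By the alternative it never
  -- vanishes, so by continuity it is never negative.
  obtain ⟨v, hv⟩ : ∃ v, 0 < supportFn x θ p v := by
    by_contra! hcon
    have hA := h.area_eq hx.periodic p
    have : 0 ≤ ∫ u in (0 : ℝ)..1, -(supportFn x θ p u * speed x u) :=
      intervalIntegral.integral_nonneg zero_le_one fun u _ => by
        have := h.speed_pos u
        have := hcon u
        nlinarith
    rw [intervalIntegral.integral_neg] at this
    have := hx.positive
    linarith
  intro u
  refine (halt u).resolve_right fun hneg => ?_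
  obtain ⟨w, -, hw⟩ := intermediate_value_uIcc (a := u) (b := v) hsc.continuousOn
    (show (0 : ℝ) ∈ uIcc _ _ from mem_uIcc.2 (Or.inl ⟨hneg.le, hv.le⟩))
  rcases halt w with h1 | h1
  · have := mul_pos hr (hpos (θ w))
    linarith
  · linarith

/-- For fixed `u`, the gap `r σ(ν) - (support of x u in direction ν)` is minimal, equal to zero, at
`ν = θ u`; so the tangential component is `r σ'(θ)`. Differentiating this along the curve gives the
radius of curvature `r (σ + σ'')`. -/
theorem speed_eq_of_range_eq (hσ : ContDiff ℝ 2 σ) (hper : Function.Periodic σ (2 * Real.pi))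
    (hpos : ∀ ν, 0 < σ ν) (h : HasAngle x (speed x) κ θ) (hx : IsJordanCurve x) (hr : 0 < r)
    (hrange : range x ⊆ (fun z : ℂ => p + r • z) '' frontier (wulffShape σ)) (u : ℝ) :
    speed x u = r * κ u * (σ (θ u) + deriv (deriv σ) (θ u)) := by
  obtain ⟨hle, hs⟩ := supportFn_eq_of_range_eq hσ.continuous hper hpos h hx hr hrange
  have hσd : ∀ ν, HasDerivAt σ (deriv σ ν) ν := fun ν =>
    (hσ.differentiable (by norm_num) ν).hasDerivAt
  have hσd' : ∀ ν, HasDerivAt (deriv σ) (deriv (deriv σ) ν) ν := fun ν =>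
    ((((contDiff_succ_iff_deriv (n := 1)).1 hσ).2.2).differentiable (by norm_num) ν).hasDerivAt
  have ht : ∀ u, tangentialFn x θ p u = r * deriv σ (θ u) := by
    intro u
    have hmin : IsLocalMin
        (fun ν => r * σ ν - ((x u - p).re * Real.sin ν - (x u - p).im * Real.cos ν)) (θ u) :=
      Eventually.of_forall fun ν => by
        have h1 := hle u ν
        have h2 := hs u
        rw [supportFn] at h2
        linarith
    have hd := ((hσd (θ u)).const_mul r).sub
      (((Real.hasDerivAt_sin (θ u)).const_mul (x u - p).re).sub
        ((Real.hasDerivAt_cos (θ u)).const_mul (x u - p).im))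
    have h0 := hmin.hasDerivAt_eq_zero hd
    rw [tangentialFn]; linarith
  have h1 := h.tangential_deriv p u
  have h2 : HasDerivAt (tangentialFn x θ p) (r * (deriv (deriv σ) (θ u) * κ u)) u := by
    rw [funext ht]
    exact ((hσd' (θ u)).comp u (h.angle u)).const_mul r
  have h3 := h1.unique h2
  rw [hs] at h3
  linear_combination h3

end wulff

/-! ### The anisoperimetric ratio gradient flow -/

theorem deriv_deriv_affine {σ : ℝ → ℝ} (a b : ℝ) (ν : ℝ) :
    deriv (deriv fun ν => a * σ ν + b) ν = a * deriv (deriv σ) ν := by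
  have : (deriv fun ν => a * σ ν + b) = fun ν => a * deriv σ ν := by
    funext ν
    rw [deriv_add_const, deriv_const_mul_field]
  rw [this, deriv_const_mul_field]

section wulffVariation

variable {σ : ℝ → ℝ} {x : ℝ → ℂ} {a b : ℝ}

/-- The rates of change of length and area along the normal velocity of the flow, for a curve
homothetic to the boundary of the Wulff shape of `a σ + b`. -/
theorem variation_of_homothetic (hσ : IsAnisotropy σ)
    (hconv : ∀ ν, 0 < σ ν + deriv (deriv σ) ν)
    (hnc : ¬ ∃ c : ℝ, ∀ ν, σ ν + deriv (deriv σ) ν = c) (ha : 0 < a) (hb : 0 < b)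
    (hx : IsJordanCurve x)
    (hhom : Homothetic (range x) (frontier (wulffShape fun ν => a * σ ν + b))) :
    0 < -∫ u in (0 : ℝ)..1, turning x u * normalVelocity σ x u ∧
      -∫ u in (0 : ℝ)..1, normalVelocity σ x u * speed x u < 0 := by
  obtain ⟨p, r, hr, hrange⟩ := hhom
  obtain ⟨θ, hθ⟩ := hx.exists_hasAngle
  have hpi := Real.pi_pos
  have hσ2 : ContDiff ℝ 2 σ := hσ.smooth.of_le (by simpa using ENat.LEInfty.out)
  have hper'' := periodic_deriv (periodic_deriv hσ.periodic)
  have hσb2 : ContDiff ℝ 2 fun ν => a * σ ν + b := (contDiff_const.mul hσ2).add contDiff_const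
  have hσbper : Function.Periodic (fun ν => a * σ ν + b) (2 * Real.pi) := fun ν => by
    simp only [hσ.periodic ν]
  have hσbpos : ∀ ν, 0 < a * σ ν + b := fun ν => by have := hσ.pos ν; positivity
  obtain ⟨-, hs⟩ := supportFn_eq_of_range_eq hσb2.continuous hσbper hσbpos hθ hx hr hrange.subset
  have hg := speed_eq_of_range_eq hσb2 hσbper hσbpos hθ hx hr hrange.subset
  simp only [deriv_deriv_affine] at hg
  have hgc := hθ.speed_cont
  have hκc := hθ.curv_cont
  have hsc := hθ.support_cont p
  have hg0 := hθ.speed_pos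
  have hg0' : ∀ u, speed x u ≠ 0 := fun u => (hg0 u).ne'
  have hA := hx.positive
  have hm : ∀ ν, 0 < a * σ ν + b + a * deriv (deriv σ) ν := fun ν => by
    nlinarith [hconv ν]
  have hκ : ∀ u, 0 < turning x u := fun u => by
    have h1 := hg0 u
    rw [hg] at h1
    exact pos_of_mul_pos_right (pos_of_mul_pos_left h1 (hm _).le) hr.le
  have hθ1 := hθ.angle_add_one hx fun u => (hκ u).le
  have htot := hθ.integral_turning hx fun u => (hκ u).le
  -- On a circle `r (a (σ + σ'') + b) = ρ` at every tangent angle. The angles fill a whole period,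
  -- so `σ + σ''` would be the constant `(ρ / r - b) / a`.
  have hcirc : ¬ ∃ ρ : ℝ, ∀ u, ρ * turning x u = speed x u := by
    rintro ⟨ρ, hρ⟩
    refine hnc ⟨(ρ / r - b) / a, fun ν => ?_⟩
    have hmper : Function.Periodic (fun ν => σ ν + deriv (deriv σ) ν) (2 * Real.pi) := fun ν => by
      simp only [hσ.periodic ν, hper'' ν]
    obtain ⟨μ, hμ, hνμ⟩ := hmper.exists_mem_Ico Real.two_pi_pos ν (θ 0)
    obtain ⟨u, -, hu⟩ := intermediate_value_Icc (zero_le_one' ℝ) hθ.angle_cont.continuousOn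
      (show μ ∈ Icc (θ 0) (θ 1) from ⟨hμ.1, by
        have := hθ1 0
        rw [zero_add] at this
        rw [this]; exact hμ.2.le⟩)
    have h1 := hρ u
    rw [hg, hu] at h1
    have h2 : ρ = r * (a * σ μ + b + a * deriv (deriv σ) μ) := by
      apply mul_right_cancel₀ (hκ u).ne'
      linarith
    rw [hνμ, h2]
    field_simp
    ring
  obtain ⟨hgage, hiso⟩ :=
    hθ.gage_isoperimetric_strict hκ hx.periodic hx.periodic_speed hθ1 hA hcirc
  rw [← length_eq_integral] at hgage hiso
  -- The support function is `r (a σ + b)`, so `σ ds` is a combination of `p ds` and `ds`, whose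
  -- integrals are `2 A` and `L`.
  have hE : energy σ x = (2 * area x / r - b * length x) / a := by
    have e : ∀ u, σ (tangentAngle x u) * speed x u =
        1 / (a * r) * (supportFn x θ p u * speed x u) - b / a * speed x u := fun u => by
      rw [hθ.comp_tangentAngle hσ.periodic, hs]
      field_simp; ring
    rw [energy, curveIntegral]
    simp_rw [e]
    rw [intervalIntegral.integral_sub (by apply Continuous.intervalIntegrable; fun_prop)
      (by apply Continuous.intervalIntegrable; fun_prop), intervalIntegral.integral_const_mul,
      intervalIntegral.integral_const_mul, ← length_eq_integral, hθ.area_eq hx.periodic p]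
    field_simp
  -- The radius of curvature formula gives `k_σ = (1/r - b k)/a`. Inserting the energy cancels the
  -- `1/r` terms and leaves `β = -(b/a)(k - L/(2A))`.
  have hβ : ∀ u, normalVelocity σ x u = (1 / r - b * (turning x u / speed x u)) / a
      - energy σ x / (2 * area x) := fun u => by
    rw [normalVelocity, anisoCurvature, hθ.comp_tangentAngle hσ.periodic,
      hθ.comp_tangentAngle hper'', hθ.curvature_eq]
    congr 1
    have h1 := hg u
    have h2 := hg0' u
    field_simp
    rw [h1]; ring
  set K₂ := ∫ u in (0 : ℝ)..1, turning x u ^ 2 / speed x u with hK₂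
  constructor
  · have e : ∀ u, turning x u * normalVelocity σ x u =
        (1 / (a * r) - energy σ x / (2 * area x)) * turning x u
          - b / a * (turning x u ^ 2 / speed x u) := fun u => by
      rw [hβ]; have := hg0' u; field_simp; ring
    simp_rw [e]
    rw [intervalIntegral.integral_sub (by apply Continuous.intervalIntegrable; fun_prop)
      (by apply Continuous.intervalIntegrable; fun_prop (disch := assumption)),
      intervalIntegral.integral_const_mul, intervalIntegral.integral_const_mul, htot, ← hK₂, hE]
    have e2 : -((1 / (a * r) - (2 * area x / r - b * length x) / a / (2 * area x)) * (2 * Real.pi)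
        - b / a * K₂) = b / a * (K₂ - Real.pi / area x * length x) := by
      field_simp; ring
    rw [e2]
    exact mul_pos (by positivity) (sub_pos.2 hgage)
  · have e : ∀ u, normalVelocity σ x u * speed x u =
        (1 / (a * r) - energy σ x / (2 * area x)) * speed x u - b / a * turning x u := fun u => by
      rw [hβ]; have := hg0' u; field_simp; ring
    simp_rw [e]
    rw [intervalIntegral.integral_sub (by apply Continuous.intervalIntegrable; fun_prop)
      (by apply Continuous.intervalIntegrable; fun_prop),
      intervalIntegral.integral_const_mul, intervalIntegral.integral_const_mul, htot, hE,
      ← length_eq_integral]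
    have e2 : -((1 / (a * r) - (2 * area x / r - b * length x) / a / (2 * area x)) * length x
        - b / a * (2 * Real.pi)) = -(b / (2 * a * area x) *
          (length x ^ 2 - 4 * Real.pi * area x)) := by
      field_simp; ring
    rw [e2, neg_lt_zero]
    exact mul_pos (by positivity) (sub_pos.2 hiso)

end wulffVariation

namespace IsGradientFlow

variable {σ : ℝ → ℝ} {T : EReal} {x : ℝ → ℝ → ℂ}

theorem hasDerivWithinAt_length_zero (h : IsGradientFlow σ T x) (hσ : ContDiff ℝ 2 σ)
    (hper : Function.Periodic σ (2 * Real.pi)) :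
    HasDerivWithinAt (fun t => length (x t))
      (-∫ u in (0 : ℝ)..1, turning (x 0) u * normalVelocity σ (x 0) u) (timeInterval T) 0 :=
  hasDerivWithinAt_zero_of_continuousOn h.pos h.continuousOn_length
    (f' := fun t => -∫ u in (0 : ℝ)..1, turning (x t) u * normalVelocity σ (x t) u)
    (continuousOn_integral
      (h.contDiffOn_turning.continuousOn.mul (h.continuousOn_normalVelocity hσ hper))).neg
    fun _ ht => h.hasDerivAt_length ht

theorem hasDerivWithinAt_area_zero (h : IsGradientFlow σ T x) (hσ : ContDiff ℝ 2 σ)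
    (hper : Function.Periodic σ (2 * Real.pi)) :
    HasDerivWithinAt (fun t => area (x t))
      (-∫ u in (0 : ℝ)..1, normalVelocity σ (x 0) u * speed (x 0) u) (timeInterval T) 0 :=
  hasDerivWithinAt_zero_of_continuousOn h.pos h.continuousOn_area
    (f' := fun t => -∫ u in (0 : ℝ)..1, normalVelocity σ (x t) u * speed (x t) u)
    (continuousOn_integral
      ((h.continuousOn_normalVelocity hσ hper).mul h.contDiffOn_speed.continuousOn)).neg
    fun _ ht => h.hasDerivAt_area ht

end IsGradientFlow

end AnisoFlow

end

theorem theorem4 :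
    (∀ (T : EReal) (x : ℝ → ℝ → ℂ), AnisoFlow.IsGradientFlow (fun _ => 1) T x →
      MonotoneOn (fun t => AnisoFlow.area (x t)) (AnisoFlow.timeInterval T) ∧
      (AnisoFlow.IsConvexCurve (x 0) →
        AntitoneOn (fun t => AnisoFlow.length (x t)) (AnisoFlow.timeInterval T))) ∧
    (∀ (σ : ℝ → ℝ), AnisoFlow.IsAnisotropy σ →
      (∀ ν, 0 < σ ν + deriv (deriv σ) ν) →
      (¬ ∃ c : ℝ, ∀ ν, σ ν + deriv (deriv σ) ν = c) →
      ∀ a b : ℝ, 0 < a → 0 < b →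
      ∀ (T : EReal) (x : ℝ → ℝ → ℂ), AnisoFlow.IsGradientFlow σ T x →
      AnisoFlow.Homothetic (Set.range (x 0))
        (frontier (AnisoFlow.wulffShape fun ν => a * σ ν + b)) →
      (∃ L' : ℝ, 0 < L' ∧ HasDerivWithinAt (fun t => AnisoFlow.length (x t)) L'
        (AnisoFlow.timeInterval T) 0) ∧
      (a / b = Real.sqrt Real.pi / Real.sqrt (AnisoFlow.wulffArea σ) →
        ∃ A' : ℝ, A' < 0 ∧ HasDerivWithinAt (fun t => AnisoFlow.area (x t)) A'
          (AnisoFlow.timeInterval T) 0)) := by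
  refine ⟨fun T x h => ⟨h.monotoneOn_area, h.antitoneOn_length⟩, ?_⟩
  intro σ hσ hconv hnc a b ha hb T x h hhom
  have hσ2 : ContDiff ℝ 2 σ := hσ.smooth.of_le (by simpa using ENat.LEInfty.out)
  obtain ⟨hL, hA⟩ := AnisoFlow.variation_of_homothetic hσ hconv hnc ha hb
    (h.jordan 0 (AnisoFlow.zero_mem_timeInterval h.pos)) hhom
  exact ⟨⟨_, hL, h.hasDerivWithinAt_length_zero hσ2 hσ.periodic⟩,
    fun _ => ⟨_, hA, h.hasDerivWithinAt_area_zero hσ2 hσ.periodic⟩⟩
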